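/- **Setting.** Let $\rho_1\neq\rho_2$ be density operators on $\mathbb C^2$ (pure or mixed), prepared with prior probabilities $q_1,q_2>0$, $q_1+q_2=1$, and let $\rho_0=q_1\rho_1+q_2\rho_2$ (which is then positive definite). A POVM is a triple $M=(M_0,M_1,M_2)$ of positive semidefinite operators with $M_0+M_1+M_2=I_2$; outcome $0$ is inconclusive. Put $$P_{\rm I}=\mathrm{tr}[\rho_0M_0],\quad P_{\rm C}=\mathrm{tr}[\rho_0M_1]+\mathrm{tr}[\rho_0M_2],\quad P_{\rm cor}=q_1\mathrm{tr}[\rho_1M_1]+q_2\mathrm{tr}[\rho_2M_2],\quad R_{\rm cor}=P_{\rm cor}/P_{\rm C}.$$ For $0\le Q\le 1$, an *FRIR measurement for $Q$* is a POVM that maximizes $P_{\rm cor}$ among all POVMs with $P_{\rm I}=Q$; for $Q<1$, $R^{\rm opt}_{\rm cor}(Q)$ is the maximum of $R_{\rm cor}$ over the POVMs with $P_{\rm I}=Q$. For $q>0$, $P_{\rm I}(q)$ is the set of the values $\mathrm{tr}[\rho_0M_0]$ taken over all POVMs that maximize $q\,\mathrm{tr}[\rho_0M_0]+q_1\mathrm{tr}[\rho_1M_1]+q_2\mathrm{tr}[\rho_2M_2]$,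 and $$q_0^{(0)}=\max\{q>0:\ 0\in P_{\rm I}(q)\}.$$ For $i=1,2$ let $C_i$ be the largest eigenvalue (the maximum confidence) of $\bar\rho_i=\rho_0^{-1/2}q_i\rho_i\rho_0^{-1/2}$ and $|\nu_i\rangle$ a corresponding unit eigenvector; label the states so that $C_1\le C_2$. Write $\bar M_i=\rho_0^{1/2}M_i\rho_0^{1/2}$, $\rho_{ij}=\langle\nu_i|\rho_0|\nu_j\rangle$, $Q_2=\rho_{22}+|\rho_{12}|^2/\rho_{22}$. Let $\boldsymbol v_i$ be the Bloch vector of $\rho_i=\frac12(I_2+\boldsymbol v_i\cdot\boldsymbol\sigma)$, $e=|q_1-q_2|$, $l=\|q_1\boldsymbol v_1-q_2\boldsymbol v_2\|_2$, and $$\gamma_{ij}=\frac{l^2-e^2}{4l}\langle\nu_i|\rho_0^{-1}|\nu_j\rangle,\quad \chi_i=\frac12+\gamma_{ii}+\frac{(2q_i-1)(2C_i-1)}{2l},\quad \chi=\frac{\chi_1+\chi_2-\sqrt{(\chi_1-\chi_2)^2+4|\gamma_{12}|^2}}{2}.$$ **Theorem.** One of the following three cases holds. 1. *$C_1\le\frac12<C_2$.*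 Then $q_0^{(0)}=1-C_1$ and $P_{\rm I}(q_0^{(0)})=[0,1-Q_2]$. For every $Q\in P_{\rm I}(q_0^{(0)})$, $$R^{\rm opt}_{\rm cor}(Q)=1-C_1+\frac{C_1-q_1}{1-Q},$$ and the FRIR measurements for $Q$ are exactly the POVMs with $$\bar M_0=Q|\nu_1\rangle\langle\nu_1|,\qquad \bar M_1=\epsilon|\nu_1\rangle\langle\nu_1|,$$ $$\bar M_2=(\rho_{11}-Q-\epsilon)|\nu_1\rangle\langle\nu_1|+\rho_{12}|\nu_1\rangle\langle\nu_2|+\rho_{21}|\nu_2\rangle\langle\nu_1|+\rho_{22}|\nu_2\rangle\langle\nu_2|,$$ where $\epsilon=0$ if $C_1<\frac12$, and $\epsilon$ is any number in $[0,1-Q_2-Q]$ if $C_1=\frac12$. 2. *$\frac12<C_1$ and $\rho_{12}=0$.* Then $q_0^{(0)}=C_1$ and $P_{\rm I}(q_0^{(0)})=[0,\rho_{11}+\rho_{22}\delta_{C_1,C_2}]$. For every $Q\in P_{\rm I}(q_0^{(0)})$, $$R^{\rm opt}_{\rm cor}(Q)=C_1+\frac{\rho_{22}(C_2-C_1)}{1-Q}\quad\text{if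 }Q<1,$$ and the FRIR measurements for $Q$ are exactly the POVMs with $$\bar M_0=(Q-\epsilon)|\nu_1\rangle\langle\nu_1|+\epsilon|\nu_2\rangle\langle\nu_2|,\quad \bar M_1=(\rho_{11}-Q+\epsilon)|\nu_1\rangle\langle\nu_1|,\quad \bar M_2=(\rho_{22}-\epsilon)|\nu_2\rangle\langle\nu_2|,$$ where $\epsilon=0$ if $C_1<C_2$, and $\epsilon$ is any number with $\max\{0,Q-\rho_{11}\}\le\epsilon\le\min\{\rho_{22},Q\}$ if $C_1=C_2$. 3. *$\frac12<C_1$ and $\rho_{12}\ne0$.* Then $q_0^{(0)}=\chi$, $P_{\rm I}(q_0^{(0)})=\{0\}$, $R^{\rm opt}_{\rm cor}(0)=\frac{1+l}2$, and the FRIR measurement for $Q=0$ is unique: $$M_0=0,\quad M_1=\frac12\Big[I_2+\frac{(q_1\boldsymbol v_1-q_2\boldsymbol v_2)\cdot\boldsymbol\sigma}{\|q_1\boldsymbol v_1-q_2\boldsymbol v_2\|_2}\Big],\quad M_2=\frac12\Big[I_2-\frac{(q_1\boldsymbol v_1-q_2\boldsymbol v_2)\cdot\boldsymbol\sigma}{\|q_1\boldsymbol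 v_1-q_2\boldsymbol v_2\|_2}\Big].$$ -/

import Mathlib

/-! Discrimination of two qubit states with a fixed rate of inconclusive results (FRIR). -/

namespace FRIR

noncomputable section

open Matrix
open scoped ComplexOrder MatrixOrder

/-- Operators on the qubit space `ℂ²`. -/
abbrev Op : Type := Matrix (Fin 2) (Fin 2) ℂ

/-- Density operators: positive semidefinite with unit trace. -/
def IsDensity (ρ : Op) : Prop := ρ.PosSemidef ∧ ρ.trace = 1

/-- The Pauli matrices `σ_x, σ_y, σ_z`. -/
def pauli : Fin 3 → Op :=
  ![!![0, 1; 1, 0], !![0, -Complex.I; Complex.I, 0], !![1, 0; 0, -1]]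

/-- `u · σ` for a real vector `u`. -/
def dotSigma (u : EuclideanSpace ℝ (Fin 3)) : Op := ∑ k, (u k : ℂ) • pauli k

/-- The Bloch vector of an operator, with coordinates `tr[ρ σ_k]`. -/
def bloch (ρ : Op) : EuclideanSpace ℝ (Fin 3) :=
  WithLp.toLp 2 fun k => ((ρ * pauli k).trace).re

/-- A density operator is recovered from its Bloch vector as `ρ = (I + v · σ) / 2`. -/
theorem IsDensity.eq_bloch {ρ : Op} (h : IsDensity ρ) :
    ρ = (1 / 2 : ℂ) • (1 + dotSigma (bloch ρ)) := by
  obtain ⟨hp, ht⟩ := h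
  have hh := hp.isHermitian
  have h00 := congrArg Complex.im (ht)
  have h00r := congrArg Complex.re (ht)
  have a01 := hh.apply 0 1
  have a00 := hh.apply 0 0
  have a11 := hh.apply 1 1
  simp only [Complex.ext_iff, Matrix.trace_fin_two, Complex.add_re, Complex.add_im,
    Complex.one_re, Complex.one_im, RCLike.star_def, Complex.conj_re, Complex.conj_im]
    at h00 h00r a01 a00 a11
  ext i j
  fin_cases i <;> fin_cases j <;>
    simp [dotSigma, bloch, pauli, Fin.sum_univ_three, Matrix.trace_fin_two, Matrix.mul_apply,
      Fin.sum_univ_two, Complex.ext_iff] <;>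
    constructor <;> linarith [a01.1, a01.2, a00.2, a11.2]

/-- An ensemble of two qubit states `ρ₁, ρ₂` with prior probabilities `q₁, q₂ > 0`. -/
structure Ensemble where
  q₁ : ℝ
  q₂ : ℝ
  ρ₁ : Op
  ρ₂ : Op
  q₁_pos : 0 < q₁
  q₂_pos : 0 < q₂
  q_sum : q₁ + q₂ = 1
  ρ₁_density : IsDensity ρ₁
  ρ₂_density : IsDensity ρ₂

/-- POVMs with outcomes `0, 1, 2`; the outcome `0` is the inconclusive one. -/
def IsPOVM (M : Fin 3 → Op) : Prop := (∀ i, (M i).PosSemidef) ∧ ∑ i, M i = 1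

/-- `⟨u|A|v⟩`. -/
def braket (u : Fin 2 → ℂ) (A : Op) (v : Fin 2 → ℂ) : ℂ := star u ⬝ᵥ (A *ᵥ v)

/-- `|u⟩⟨v|`. -/
def ketbra (u v : Fin 2 → ℂ) : Op := vecMulVec u (star v)

/-- `C` is the largest eigenvalue of `A`, and `ν` is a unit eigenvector for it. -/
def IsTopEigenpair (A : Op) (C : ℝ) (ν : Fin 2 → ℂ) : Prop :=
  IsGreatest {x : ℝ | Module.End.HasEigenvalue (Matrix.toLin' A) (x : ℂ)} C ∧
    A *ᵥ ν = (C : ℂ) • ν ∧ star ν ⬝ᵥ ν = 1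

namespace Ensemble

variable (E : Ensemble)

/-- The average state `ρ₀ = q₁ ρ₁ + q₂ ρ₂`. -/
def ρ₀ : Op := (E.q₁ : ℂ) • E.ρ₁ + (E.q₂ : ℂ) • E.ρ₂

/-- The positive square root `ρ₀^{1/2}`. -/
def sqrtρ₀ : Op := CFC.sqrt E.ρ₀

/-- `ρ̄₁ = ρ₀^{-1/2} q₁ ρ₁ ρ₀^{-1/2}`. -/
def ρbar₁ : Op := E.sqrtρ₀⁻¹ * ((E.q₁ : ℂ) • E.ρ₁) * E.sqrtρ₀⁻¹

/-- `ρ̄₂ = ρ₀^{-1/2} q₂ ρ₂ ρ₀^{-1/2}`. -/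
def ρbar₂ : Op := E.sqrtρ₀⁻¹ * ((E.q₂ : ℂ) • E.ρ₂) * E.sqrtρ₀⁻¹

/-- `M̄ = ρ₀^{1/2} M ρ₀^{1/2}`. -/
def bar (M : Op) : Op := E.sqrtρ₀ * M * E.sqrtρ₀

/-- Probability of an inconclusive result, `P_I = tr[ρ₀ M₀]`. -/
def probI (M : Fin 3 → Op) : ℝ := ((E.ρ₀ * M 0).trace).re

/-- Probability of a conclusive result, `P_C = tr[ρ₀ M₁] + tr[ρ₀ M₂]`. -/
def probC (M : Fin 3 → Op) : ℝ := ((E.ρ₀ * M 1).trace).re + ((E.ρ₀ * M 2).trace).re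

/-- Probability of a correct guess, `P_cor = q₁ tr[ρ₁ M₁] + q₂ tr[ρ₂ M₂]`. -/
def probCor (M : Fin 3 → Op) : ℝ :=
  E.q₁ * ((E.ρ₁ * M 1).trace).re + E.q₂ * ((E.ρ₂ * M 2).trace).re

/-- `R_cor = P_cor / P_C`. -/
def rateCor (M : Fin 3 → Op) : ℝ := E.probCor M / E.probC M

/-- The value `R` is `R_cor^opt(Q)`, the maximum of `R_cor` over the POVMs with `P_I = Q`. -/
def IsOptRate (Q R : ℝ) : Prop :=
  IsGreatest {r : ℝ | ∃ M, IsPOVM M ∧ E.probI M = Q ∧ E.rateCor M = r} R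

/-- `M` is an optimal FRIR measurement for `P_I = Q`: it maximizes `P_cor` among the POVMs with
`P_I = Q`. -/
def IsFRIRMeasurement (Q : ℝ) (M : Fin 3 → Op) : Prop :=
  IsPOVM M ∧ E.probI M = Q ∧
    ∀ M', IsPOVM M' → E.probI M' = Q → E.probCor M' ≤ E.probCor M

/-- Objective of the modified problem with inconclusive degree `q`,
`q tr[ρ₀ M₀] + q₁ tr[ρ₁ M₁] + q₂ tr[ρ₂ M₂]`. -/
def modCor (q : ℝ) (M : Fin 3 → Op) : ℝ := q * E.probI M + E.probCor M

/-- `M` is an optimal POVM of the modified problem with inconclusive degree `q`. -/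
def IsModOptimal (q : ℝ) (M : Fin 3 → Op) : Prop :=
  IsPOVM M ∧ ∀ M', IsPOVM M' → E.modCor q M' ≤ E.modCor q M

/-- `P_I(q)`: the inconclusive probabilities of the optimal POVMs of the modified problem. -/
def PI (q : ℝ) : Set ℝ := {Q | ∃ M, E.IsModOptimal q M ∧ E.probI M = Q}

/-- `q` is `q₀⁽⁰⁾ = max {q > 0 : 0 ∈ P_I(q)}`. -/
def IsStartDegree (q : ℝ) : Prop := IsGreatest {q : ℝ | 0 < q ∧ (0 : ℝ) ∈ E.PI q} q

/-- `e = |q₁ - q₂|`. -/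
def e : ℝ := |E.q₁ - E.q₂|

/-- The difference `q₁ v₁ - q₂ v₂` of the weighted Bloch vectors. -/
def blochDiff : EuclideanSpace ℝ (Fin 3) := E.q₁ • bloch E.ρ₁ - E.q₂ • bloch E.ρ₂

/-- `l = ‖q₁ v₁ - q₂ v₂‖₂`. -/
def l : ℝ := ‖E.blochDiff‖

/-- `Q₂ = ρ₂₂ + |ρ₁₂|² / ρ₂₂`, where `ρ_ij = ⟨ν_i|ρ₀|ν_j⟩`. -/
def Q₂ (ν₁ ν₂ : Fin 2 → ℂ) : ℝ :=
  (braket ν₂ E.ρ₀ ν₂).re + ‖braket ν₁ E.ρ₀ ν₂‖ ^ 2 / (braket ν₂ E.ρ₀ ν₂).re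

/-- `γ(u, v) = (l² - e²) / (4 l) ⟨u|ρ₀⁻¹|v⟩`, so that `γ_ij = γ(ν_i, ν_j)`. -/
def γ (u v : Fin 2 → ℂ) : ℂ := (((E.l ^ 2 - E.e ^ 2) / (4 * E.l) : ℝ) : ℂ) * braket u E.ρ₀⁻¹ v

/-- `χ₁ = 1/2 + γ₁₁ + (2 q₁ - 1) (2 C₁ - 1) / (2 l)`. -/
def χ₁ (C₁ : ℝ) (ν₁ : Fin 2 → ℂ) : ℝ :=
  1 / 2 + (E.γ ν₁ ν₁).re + (2 * E.q₁ - 1) * (2 * C₁ - 1) / (2 * E.l)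

/-- `χ₂ = 1/2 + γ₂₂ + (2 q₂ - 1) (2 C₂ - 1) / (2 l)`. -/
def χ₂ (C₂ : ℝ) (ν₂ : Fin 2 → ℂ) : ℝ :=
  1 / 2 + (E.γ ν₂ ν₂).re + (2 * E.q₂ - 1) * (2 * C₂ - 1) / (2 * E.l)

/-- `χ = (χ₁ + χ₂ - √((χ₁ - χ₂)² + 4 |γ₁₂|²)) / 2`. -/
def χ (C₁ C₂ : ℝ) (ν₁ ν₂ : Fin 2 → ℂ) : ℝ :=
  (E.χ₁ C₁ ν₁ + E.χ₂ C₂ ν₂ -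
    √((E.χ₁ C₁ ν₁ - E.χ₂ C₂ ν₂) ^ 2 + 4 * ‖E.γ ν₁ ν₂‖ ^ 2)) / 2

end Ensemble

end

end FRIR

/-! ### Positive semidefinite and Hermitian 2×2 matrices. -/

namespace FRIR

open Matrix
open scoped ComplexOrder MatrixOrder

/-! Since `ρbar₁ + ρbar₂ = 1`, the two operators share their eigenvectors. As `ρ₁ ≠ ρ₂` forces `C₁ +
C₂ > 1` (`one_lt_add`), `ν₁` and `ν₂` belong to the distinct eigenvalues `C₁` and `1 - C₂` of
`ρbar₁`, hence form an orthonormal basis. With `W = ρ₀^{1/2} [ν₁ ν₂]`, the congruence `M ↦ Wᴴ M W`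
turns POVMs into triples of positive semidefinite matrices summing to the Gram matrix `(ρ_ij)`, and
all probabilities become linear in diagonal entries.

Each case is an instance of linear duality: at the right degree `q₀`, the modified objective equals
a constant `V` minus a nonnegative `loss`. The optimal measurements are then those of zero loss
(`mem_PI_iff`, `isFRIRMeasurement_iff`). When `C₁ ≤ 1/2`, or `1/2 < C₁` and `ρ₁₂ = 0`, the loss is a
nonnegative combination of diagonal entries. A positive semidefinite matrix with a vanishing
diagonal entry loses its whole row and column, so zero loss determines the measurements explicitly.
A zero-loss measurement with `P_I > 0` beats `V` as soon as `q > q₀`, which makes `q₀` maximal.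

In the remaining case, `q₁ρ₁ - q₂ρ₂ = sP - t(1 - P)` with `s, t > 0`, and `K = q₁ρ₁ + t(1 - P)` is
the dual operator of minimum-error discrimination. In the basis `ν₁, ν₂`, the smaller eigenvalue of
`ρ₀^{-1/2} K ρ₀^{-1/2}` is `χ`, so `K - χρ₀` is positive semidefinite and singular (`slack_χ`). Zero
loss makes `M₀` commute with `P`. If `M₀ ≠ 0`, an eigenvector of `P` would lie in the kernel of `K -
χρ₀`, forcing `ρ₁₂ = 0` (`eq_zero_of_slack_mulVec`); so only the Helstrom measurement survives. For
`q > χ`, a perturbation along that kernel gains at first order and costs only at second order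
(`exists_modCor_gt`). -/

theorem exists_isHermitian_sq {A : Op} (hA : A.PosSemidef) : ∃ X : Op, Xᴴ = X ∧ X * X = A :=
  ⟨CFC.sqrt A, (CFC.sqrt_nonneg A).posSemidef.isHermitian, CFC.sqrt_mul_sqrt_self A hA.nonneg⟩

theorem trace_mul_nonneg {A B : Op} (hA : A.PosSemidef) (hB : B.PosSemidef) :
    0 ≤ (A * B).trace.re := by
  obtain ⟨X, hX, rfl⟩ := exists_isHermitian_sq hA
  have h := (hB.mul_mul_conjTranspose_same X).trace_nonneg
  rw [hX, Matrix.trace_mul_comm, ← Matrix.mul_assoc] at h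
  exact (Complex.le_def.1 h).1

/-- With `A = X²` and `B = Y²`, the trace is the squared Hilbert–Schmidt norm of `Y X`. This is
complementary slackness: it turns a vanishing loss term into an operator equation. -/
theorem mul_eq_zero_of_trace {A B : Op} (hA : A.PosSemidef) (hB : B.PosSemidef)
    (h : (A * B).trace.re = 0) : A * B = 0 := by
  obtain ⟨X, hX, rfl⟩ := exists_isHermitian_sq hA
  obtain ⟨Y, hY, rfl⟩ := exists_isHermitian_sq hB
  have e : (X * X * (Y * Y)).trace = ((Y * X)ᴴ * (Y * X)).trace := by
    rw [Matrix.conjTranspose_mul, hX, hY, Matrix.mul_assoc, Matrix.trace_mul_comm]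
    simp only [Matrix.mul_assoc]
  have hp := (Matrix.posSemidef_conjTranspose_mul_self (Y * X))
  have h0 : ((Y * X)ᴴ * (Y * X)).trace = 0 := by
    have h1 := Complex.le_def.1 hp.trace_nonneg
    apply Complex.ext
    · rw [← e, h]; rfl
    · exact h1.2.symm
  rw [Matrix.trace_conjTranspose_mul_self_eq_zero_iff] at h0
  have h1 : X * Y = 0 := by
    have := congrArg Matrix.conjTranspose h0
    rwa [Matrix.conjTranspose_mul, hX, hY, Matrix.conjTranspose_zero] at this
  rw [Matrix.mul_assoc, ← Matrix.mul_assoc X Y, h1]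
  simp

theorem mulVec_ne_zero_exists {A : Op} (h : A ≠ 0) : ∃ z, A *ᵥ z ≠ 0 := by
  by_contra! hc
  exact h (Matrix.ext_of_mulVec_single fun i => by rw [hc, Matrix.zero_mulVec])

theorem im_diag_eq_zero {N : Op} (hN : N.PosSemidef) (i : Fin 2) : (N i i).im = 0 :=
  (Complex.le_def.1 (hN.diag_nonneg (i := i))).2.symm

theorem re_diag_nonneg {N : Op} (hN : N.PosSemidef) (i : Fin 2) : 0 ≤ (N i i).re :=
  (Complex.le_def.1 (hN.diag_nonneg (i := i))).1

theorem diag_eq_re {N : Op} (hN : N.PosSemidef) (i : Fin 2) : N i i = ((N i i).re : ℂ) :=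
  Complex.ext rfl (by simp [im_diag_eq_zero hN i])

theorem norm_sq_le_of_posSemidef {N : Op} (hN : N.PosSemidef) :
    ‖N 0 1‖ ^ 2 ≤ (N 0 0).re * (N 1 1).re := by
  have h := (Complex.le_def.1 hN.det_nonneg).1
  rw [Matrix.det_fin_two, ← hN.isHermitian.apply 1 0, RCLike.star_def, Complex.mul_conj] at h
  rw [Complex.sq_norm]
  simp [Complex.mul_re, im_diag_eq_zero hN] at h
  linarith

/-- The determinant bound kills the off-diagonal entries. This is how a vanishing loss coefficient
pins down a whole POVM element. -/
theorem eq_of_re_one_one {N : Op} (hN : N.PosSemidef) (h : (N 1 1).re = 0) :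
    N = !![((N 0 0).re : ℂ), 0; 0, 0] := by
  have h1 := norm_sq_le_of_posSemidef hN
  rw [h, mul_zero] at h1
  have h2 : N 0 1 = 0 := by
    rw [← norm_eq_zero]; exact pow_eq_zero_iff two_ne_zero |>.1 (le_antisymm h1 (sq_nonneg _))
  have h3 : N 1 0 = 0 := by rw [← hN.isHermitian.apply 1 0, h2, star_zero]
  ext i j
  fin_cases i <;> fin_cases j <;> simp [h2, h3, ← diag_eq_re hN]
  rw [diag_eq_re hN, h, Complex.ofReal_zero]

theorem eq_of_re_zero_zero {N : Op} (hN : N.PosSemidef) (h : (N 0 0).re = 0) :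
    N = !![0, 0; 0, ((N 1 1).re : ℂ)] := by
  have h1 := norm_sq_le_of_posSemidef hN
  rw [h, zero_mul] at h1
  have h2 : N 0 1 = 0 := by
    rw [← norm_eq_zero]; exact pow_eq_zero_iff two_ne_zero |>.1 (le_antisymm h1 (sq_nonneg _))
  have h3 : N 1 0 = 0 := by rw [← hN.isHermitian.apply 1 0, h2, star_zero]
  ext i j
  fin_cases i <;> fin_cases j <;> simp [h2, h3, ← diag_eq_re hN]
  rw [diag_eq_re hN, h, Complex.ofReal_zero]

theorem posSemidef_diagonal_two {a d : ℝ} (ha : 0 ≤ a) (hd : 0 ≤ d) :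
    (!![(a : ℂ), 0; 0, (d : ℂ)] : Op).PosSemidef := by
  have h : (!![(a : ℂ), 0; 0, (d : ℂ)] : Op) = Matrix.diagonal ![(a : ℂ), (d : ℂ)] := by
    ext i j; fin_cases i <;> fin_cases j <;> simp
  rw [h, Matrix.posSemidef_diagonal_iff]
  intro i; fin_cases i <;> simpa

/-- Schur complement: the matrix is a rank-one positive part plus `a - |b|²/d` in the first corner.
-/
theorem posSemidef_fin_two {a d : ℝ} {b c : ℂ} (hd : 0 < d) (hc : c = star b)
    (h : ‖b‖ ^ 2 ≤ a * d) : (!![(a : ℂ), b; c, (d : ℂ)] : Op).PosSemidef := by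
  have key : (!![(a : ℂ), b; c, (d : ℂ)] : Op) =
      (1 / d : ℝ) • vecMulVec ![b, (d : ℂ)] (star ![b, (d : ℂ)]) +
        !![((a - ‖b‖ ^ 2 / d : ℝ) : ℂ), 0; 0, ((0 : ℝ) : ℂ)] := by
    have hd' : (d : ℂ) ≠ 0 := by exact_mod_cast hd.ne'
    have hb : b * star b = ((‖b‖ ^ 2 : ℝ) : ℂ) := by
      rw [RCLike.star_def, Complex.mul_conj, Complex.sq_norm]
    ext i j
    simp only [Matrix.add_apply, Matrix.smul_apply, vecMulVec_apply, Pi.star_apply]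
    fin_cases i <;> fin_cases j <;> simp [hc] <;> field_simp
    simp at hb
    rw [hb]
    ring
  rw [key]
  refine Matrix.PosSemidef.add ((posSemidef_vecMulVec_self_star _).smul (by positivity)) ?_
  refine posSemidef_diagonal_two ?_ le_rfl
  rw [sub_nonneg, div_le_iff₀ hd]
  exact h

theorem hasEigenvalue_iff {A : Op} {x : ℂ} :
    Module.End.HasEigenvalue (Matrix.toLin' A) x ↔ ∃ v, v ≠ 0 ∧ A *ᵥ v = x • v := by
  constructor
  · intro h
    obtain ⟨v, hv⟩ := h.exists_hasEigenvector
    exact ⟨v, hv.2, by simpa using hv.apply_eq_smul⟩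
  · rintro ⟨v, hv, h⟩
    exact Module.End.hasEigenvalue_of_hasEigenvector
      ⟨Module.End.mem_eigenspace_iff.2 (by simpa using h), hv⟩

theorem eq_smul_one_of_eigenvalues {A : Op} (hA : A.IsHermitian) {c : ℝ}
    (h : ∀ (x : ℝ) (v : Fin 2 → ℂ), v ≠ 0 → A *ᵥ v = (x : ℂ) • v → x = c) :
    A = (c : ℂ) • (1 : Op) := by
  have hc : ∀ i, hA.eigenvalues i = c := fun i =>
    h _ _ (fun h0 => hA.eigenvectorBasis.toBasis.ne_zero i (by
      rw [OrthonormalBasis.coe_toBasis]; ext j; exact congrFun h0 j))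
      (by simpa using hA.mulVec_eigenvectorBasis i)
  have hs := hA.spectral_theorem
  have hd : (diagonal (RCLike.ofReal ∘ hA.eigenvalues) : Op) = (c : ℂ) • (1 : Op) := by
    rw [← Matrix.diagonal_one, ← Matrix.diagonal_smul]
    congr 1
    ext i
    simp [hc]
  rw [hd, map_smul, map_one] at hs
  exact hs

/-- A traceless Hermitian operator with nontrivial kernel vanishes. -/
theorem eq_zero_of_trace_of_mulVec {D : Op} (hD : D.IsHermitian) (ht : D.trace = 0)
    {x : Fin 2 → ℂ} (hx : x ≠ 0) (h : D *ᵥ x = 0) : D = 0 := by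
  have hdet : D.det = 0 := Matrix.exists_mulVec_eq_zero_iff.1 ⟨x, hx, h⟩
  have h10 := hD.apply 1 0
  have h00 := hD.apply 0 0
  rw [Matrix.trace_fin_two] at ht
  -- Zero trace and real diagonal make the determinant `-(D₀₀² + |D₀₁|²)`, so its vanishing kills
  -- every entry.
  have h11 : D 1 1 = -D 0 0 := by linear_combination ht
  rw [Matrix.det_fin_two, ← h10, h11] at hdet
  have hre := congrArg Complex.re hdet
  have h0 := congrArg Complex.im h00
  simp at hre h0
  have i0 : (D 0 0).im = 0 := by linarith
  rw [i0] at hre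
  have r0 : (D 0 0).re = 0 := by nlinarith [sq_nonneg (D 0 1).re, sq_nonneg (D 0 1).im]
  have r1 : (D 0 1).re = 0 := by nlinarith [sq_nonneg (D 0 1).re, sq_nonneg (D 0 1).im]
  have i1 : (D 0 1).im = 0 := by nlinarith [sq_nonneg (D 0 1).re, sq_nonneg (D 0 1).im]
  have e0 : D 0 0 = 0 := Complex.ext r0 i0
  have e1 : D 0 1 = 0 := Complex.ext r1 i1
  rw [e1] at h10
  ext i j
  fin_cases i <;> fin_cases j <;> simp [e0, e1, h11, ← h10]

/-! ### Change of basis to `ν₁, ν₂`. -/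

/-- The operator with columns `ν₁, ν₂`. -/
def colOp (ν₁ ν₂ : Fin 2 → ℂ) : Op := Matrix.of fun i j => ![ν₁ i, ν₂ i] j

theorem conjTranspose_colOp_mul_mul (ν₁ ν₂ : Fin 2 → ℂ) (A : Op) :
    (colOp ν₁ ν₂)ᴴ * A * colOp ν₁ ν₂ =
      !![braket ν₁ A ν₁, braket ν₁ A ν₂; braket ν₂ A ν₁, braket ν₂ A ν₂] := by
  ext i j
  fin_cases i <;> fin_cases j <;>
    simp [colOp, braket, Matrix.mul_apply, Fin.sum_univ_two, dotProduct, mulVec] <;> ring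

theorem colOp_mul_mul_conjTranspose (ν₁ ν₂ : Fin 2 → ℂ) (a b c d : ℂ) :
    colOp ν₁ ν₂ * !![a, b; c, d] * (colOp ν₁ ν₂)ᴴ =
      a • ketbra ν₁ ν₁ + b • ketbra ν₁ ν₂ + c • ketbra ν₂ ν₁ + d • ketbra ν₂ ν₂ := by
  ext i j
  simp [colOp, ketbra, Matrix.mul_apply, Fin.sum_univ_two, vecMulVec_apply]
  ring

theorem mul_colOp {A : Op} {ν₁ ν₂ : Fin 2 → ℂ} {a b : ℂ} (h₁ : A *ᵥ ν₁ = a • ν₁)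
    (h₂ : A *ᵥ ν₂ = b • ν₂) : A * colOp ν₁ ν₂ = colOp ν₁ ν₂ * !![a, 0; 0, b] := by
  ext i j
  have e₁ := congrFun h₁ i
  have e₂ := congrFun h₂ i
  simp only [mulVec, dotProduct, Fin.sum_univ_two, Pi.smul_apply, smul_eq_mul] at e₁ e₂
  fin_cases j <;> simp [colOp, Matrix.mul_apply, Fin.sum_univ_two, e₁, e₂, mul_comm]

theorem braket_one (u v : Fin 2 → ℂ) : braket u 1 v = star u ⬝ᵥ v := by simp [braket]

theorem dotProduct_eq_zero_of_eigenvectors {A : Op} (hA : A.IsHermitian) {u v : Fin 2 → ℂ}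
    {a b : ℝ} (hu : A *ᵥ u = (a : ℂ) • u) (hv : A *ᵥ v = (b : ℂ) • v) (hab : a ≠ b) :
    star u ⬝ᵥ v = 0 := by
  have h : star (A *ᵥ u) ⬝ᵥ v = star u ⬝ᵥ (A *ᵥ v) := by
    rw [Matrix.star_mulVec, ← Matrix.dotProduct_mulVec, hA.eq]
  rw [hu, hv, star_smul, smul_dotProduct, dotProduct_smul, smul_eq_mul, smul_eq_mul,
    Complex.star_def, Complex.conj_ofReal] at h
  have h' : ((a : ℂ) - b) * (star u ⬝ᵥ v) = 0 := by linear_combination h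
  exact (mul_eq_zero.1 h').resolve_left (sub_ne_zero.2 (by exact_mod_cast hab))

/-! ### Simultaneous diagonalization of the two weighted states. -/

namespace Ensemble

variable {E : Ensemble}

theorem q₁_smul_posSemidef (E : Ensemble) : ((E.q₁ : ℂ) • E.ρ₁).PosSemidef :=
  E.ρ₁_density.1.smul (by exact_mod_cast E.q₁_pos.le)

theorem q₂_smul_posSemidef (E : Ensemble) : ((E.q₂ : ℂ) • E.ρ₂).PosSemidef :=
  E.ρ₂_density.1.smul (by exact_mod_cast E.q₂_pos.le)

theorem ρ₀_posSemidef (E : Ensemble) : E.ρ₀.PosSemidef :=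
  E.q₁_smul_posSemidef.add E.q₂_smul_posSemidef

theorem trace_ρ₀ (E : Ensemble) : E.ρ₀.trace = 1 := by
  simp only [ρ₀, Matrix.trace_add, Matrix.trace_smul, E.ρ₁_density.2, E.ρ₂_density.2, smul_eq_mul,
    mul_one]
  exact_mod_cast E.q_sum

/-- A kernel vector of `ρ₀` is annihilated by both states, hence by the traceless Hermitian operator
`ρ₁ - ρ₂`, which must then vanish. -/
theorem ρ₀_posDef (hne : E.ρ₁ ≠ E.ρ₂) : E.ρ₀.PosDef := by
  rw [E.ρ₀_posSemidef.posDef_iff_det_ne_zero]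
  intro hdet
  obtain ⟨x, hx, h⟩ := Matrix.exists_mulVec_eq_zero_iff.2 hdet
  have hsum : star x ⬝ᵥ (((E.q₁ : ℂ) • E.ρ₁) *ᵥ x) + star x ⬝ᵥ (((E.q₂ : ℂ) • E.ρ₂) *ᵥ x) = 0 := by
    rw [← dotProduct_add, ← Matrix.add_mulVec]
    change star x ⬝ᵥ (E.ρ₀ *ᵥ x) = 0
    rw [h, dotProduct_zero]
  have n₁ := E.q₁_smul_posSemidef.dotProduct_mulVec_nonneg x
  have n₂ := E.q₂_smul_posSemidef.dotProduct_mulVec_nonneg x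
  obtain ⟨z₁, z₂⟩ := (add_eq_zero_iff_of_nonneg n₁ n₂).1 hsum
  rw [E.q₁_smul_posSemidef.dotProduct_mulVec_zero_iff, Matrix.smul_mulVec] at z₁
  rw [E.q₂_smul_posSemidef.dotProduct_mulVec_zero_iff, Matrix.smul_mulVec] at z₂
  have e₁ := (smul_eq_zero.1 z₁).resolve_left (by exact_mod_cast E.q₁_pos.ne')
  have e₂ := (smul_eq_zero.1 z₂).resolve_left (by exact_mod_cast E.q₂_pos.ne')
  refine hne (sub_eq_zero.1 (eq_zero_of_trace_of_mulVec
    (E.ρ₁_density.1.isHermitian.sub E.ρ₂_density.1.isHermitian) ?_ hx ?_))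
  · rw [Matrix.trace_sub, E.ρ₁_density.2, E.ρ₂_density.2, sub_self]
  · rw [Matrix.sub_mulVec, e₁, e₂, sub_zero]

theorem conjTranspose_sqrtρ₀ (E : Ensemble) : E.sqrtρ₀ᴴ = E.sqrtρ₀ :=
  (CFC.sqrt_nonneg E.ρ₀).posSemidef.isHermitian

theorem sqrtρ₀_mul_self (E : Ensemble) : E.sqrtρ₀ * E.sqrtρ₀ = E.ρ₀ :=
  CFC.sqrt_mul_sqrt_self E.ρ₀ E.ρ₀_posSemidef.nonneg

theorem isUnit_det_sqrtρ₀ (hne : E.ρ₁ ≠ E.ρ₂) : IsUnit E.sqrtρ₀.det := by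
  have h := (ρ₀_posDef hne).isUnit
  rw [Matrix.isUnit_iff_isUnit_det, ← E.sqrtρ₀_mul_self, Matrix.det_mul] at h
  exact isUnit_of_mul_isUnit_left h

theorem ρbar₁_add_ρbar₂ (hne : E.ρ₁ ≠ E.ρ₂) : E.ρbar₁ + E.ρbar₂ = 1 := by
  have hS := isUnit_det_sqrtρ₀ hne
  rw [ρbar₁, ρbar₂, ← Matrix.add_mul, ← Matrix.mul_add]
  change E.sqrtρ₀⁻¹ * E.ρ₀ * E.sqrtρ₀⁻¹ = 1
  rw [← E.sqrtρ₀_mul_self, ← Matrix.mul_assoc, Matrix.nonsing_inv_mul _ hS, Matrix.one_mul,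
    Matrix.mul_nonsing_inv _ hS]

theorem ρbar₁_isHermitian (E : Ensemble) : E.ρbar₁.IsHermitian := by
  have h := (E.q₁_smul_posSemidef.conjTranspose_mul_mul_same E.sqrtρ₀⁻¹).isHermitian
  rwa [Matrix.conjTranspose_nonsing_inv, conjTranspose_sqrtρ₀] at h

theorem sqrtρ₀_mul_ρbar₁_mul (hne : E.ρ₁ ≠ E.ρ₂) :
    E.sqrtρ₀ * E.ρbar₁ * E.sqrtρ₀ = (E.q₁ : ℂ) • E.ρ₁ := by
  have hS := isUnit_det_sqrtρ₀ hne
  rw [ρbar₁]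
  simp only [Matrix.mul_assoc, Matrix.nonsing_inv_mul _ hS, Matrix.mul_one]
  rw [← Matrix.mul_assoc, Matrix.mul_nonsing_inv _ hS, Matrix.one_mul]

variable {C₁ C₂ : ℝ} {ν₁ ν₂ : Fin 2 → ℂ}

theorem ρbar₁_mulVec_of_ρbar₂ (hne : E.ρ₁ ≠ E.ρ₂) {x : ℝ} {v : Fin 2 → ℂ}
    (h : E.ρbar₂ *ᵥ v = (x : ℂ) • v) : E.ρbar₁ *ᵥ v = ((1 - x : ℝ) : ℂ) • v := by
  rw [eq_sub_of_add_eq (ρbar₁_add_ρbar₂ hne), Matrix.sub_mulVec, h, Matrix.one_mulVec]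
  push_cast
  rw [sub_smul, one_smul]

theorem ρbar₂_mulVec_of_ρbar₁ (hne : E.ρ₁ ≠ E.ρ₂) {x : ℝ} {v : Fin 2 → ℂ}
    (h : E.ρbar₁ *ᵥ v = (x : ℂ) • v) : E.ρbar₂ *ᵥ v = ((1 - x : ℝ) : ℂ) • v := by
  rw [eq_sub_of_add_eq' (ρbar₁_add_ρbar₂ hne), Matrix.sub_mulVec, h, Matrix.one_mulVec]
  push_cast
  rw [sub_smul, one_smul]

theorem ne_zero_of_isTopEigenpair {A : Op} {C : ℝ} {ν : Fin 2 → ℂ} (h : IsTopEigenpair A C ν) :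
    ν ≠ 0 := by
  rintro rfl
  simpa using h.2.2

/-- An eigenvalue `x` of `ρbar₁` satisfies `x ≤ C₁` and `1 - x ≤ C₂`. If `C₁ + C₂ ≤ 1` this leaves
only `x = C₁`, so `ρbar₁` is scalar and `ρ₁` is proportional to `ρ₀`; comparing traces gives `ρ₁ =
ρ₀`, hence `ρ₁ = ρ₂`. -/
theorem one_lt_add (hne : E.ρ₁ ≠ E.ρ₂) (h₁ : IsTopEigenpair E.ρbar₁ C₁ ν₁)
    (h₂ : IsTopEigenpair E.ρbar₂ C₂ ν₂) : 1 < C₁ + C₂ := by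
  have hle : 1 - C₂ ≤ C₁ := h₁.1.2 (hasEigenvalue_iff.2
    ⟨ν₂, ne_zero_of_isTopEigenpair h₂, ρbar₁_mulVec_of_ρbar₂ hne h₂.2.1⟩)
  by_contra hcon
  have hs : E.ρbar₁ = (C₁ : ℂ) • (1 : Op) := by
    refine eq_smul_one_of_eigenvalues E.ρbar₁_isHermitian fun x v hv hx => ?_
    have a := h₁.1.2 (hasEigenvalue_iff.2 ⟨v, hv, hx⟩)
    have b := h₂.1.2 (hasEigenvalue_iff.2 ⟨v, hv, ρbar₂_mulVec_of_ρbar₁ hne hx⟩)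
    linarith
  have h := sqrtρ₀_mul_ρbar₁_mul hne
  rw [hs, Matrix.mul_smul, Matrix.smul_mul, Matrix.mul_one, E.sqrtρ₀_mul_self] at h
  have ht := congrArg Matrix.trace h
  rw [Matrix.trace_smul, Matrix.trace_smul, E.trace_ρ₀, E.ρ₁_density.2, smul_eq_mul, smul_eq_mul,
    mul_one, mul_one] at ht
  have hq₁ : (E.q₁ : ℂ) ≠ 0 := by exact_mod_cast E.q₁_pos.ne'
  have hq₂ : (E.q₂ : ℂ) ≠ 0 := by exact_mod_cast E.q₂_pos.ne'
  have hqs : (E.q₁ : ℂ) + E.q₂ = 1 := by exact_mod_cast E.q_sum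
  rw [ht] at h
  have h0 : (E.q₁ : ℂ) • E.ρ₁ + (E.q₂ : ℂ) • E.ρ₂ = E.ρ₁ := smul_right_injective _ hq₁ h
  refine hne (smul_right_injective _ hq₂ ?_)
  change (E.q₂ : ℂ) • E.ρ₁ = (E.q₂ : ℂ) • E.ρ₂
  rw [eq_sub_of_add_eq' h0, eq_sub_of_add_eq' hqs, sub_smul, one_smul]

/-- The operator `ρ₀^{1/2} [ν₁ ν₂]`. -/
noncomputable def W (E : Ensemble) (ν₁ ν₂ : Fin 2 → ℂ) : Op := E.sqrtρ₀ * colOp ν₁ ν₂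

theorem conjTranspose_W (E : Ensemble) (ν₁ ν₂ : Fin 2 → ℂ) :
    (E.W ν₁ ν₂)ᴴ = (colOp ν₁ ν₂)ᴴ * E.sqrtρ₀ := by
  rw [W, Matrix.conjTranspose_mul, conjTranspose_sqrtρ₀]

theorem conjTranspose_W_mul_W (E : Ensemble) (ν₁ ν₂ : Fin 2 → ℂ) :
    (E.W ν₁ ν₂)ᴴ * E.W ν₁ ν₂ = !![braket ν₁ E.ρ₀ ν₁, braket ν₁ E.ρ₀ ν₂;
      braket ν₂ E.ρ₀ ν₁, braket ν₂ E.ρ₀ ν₂] := by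
  rw [conjTranspose_W, W, ← conjTranspose_colOp_mul_mul, ← E.sqrtρ₀_mul_self]
  simp only [Matrix.mul_assoc]

theorem conjTranspose_colOp_mul_colOp (hne : E.ρ₁ ≠ E.ρ₂) (h₁ : IsTopEigenpair E.ρbar₁ C₁ ν₁)
    (h₂ : IsTopEigenpair E.ρbar₂ C₂ ν₂) : (colOp ν₁ ν₂)ᴴ * colOp ν₁ ν₂ = 1 := by
  have h := one_lt_add hne h₁ h₂
  have h12 := dotProduct_eq_zero_of_eigenvectors E.ρbar₁_isHermitian h₁.2.1
    (ρbar₁_mulVec_of_ρbar₂ hne h₂.2.1) (by linarith)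
  have h21 := dotProduct_eq_zero_of_eigenvectors E.ρbar₁_isHermitian
    (ρbar₁_mulVec_of_ρbar₂ hne h₂.2.1) h₁.2.1 (by linarith)
  have key := conjTranspose_colOp_mul_mul ν₁ ν₂ 1
  rw [Matrix.mul_one] at key
  rw [key, braket_one, braket_one, braket_one, braket_one, h12, h21, h₁.2.2, h₂.2.2,
    Matrix.one_fin_two]

theorem colOp_mul_conjTranspose_colOp (hne : E.ρ₁ ≠ E.ρ₂) (h₁ : IsTopEigenpair E.ρbar₁ C₁ ν₁)
    (h₂ : IsTopEigenpair E.ρbar₂ C₂ ν₂) : colOp ν₁ ν₂ * (colOp ν₁ ν₂)ᴴ = 1 :=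
  mul_eq_one_comm.1 (conjTranspose_colOp_mul_colOp hne h₁ h₂)

theorem W_mul_conjTranspose_W (hne : E.ρ₁ ≠ E.ρ₂) (h₁ : IsTopEigenpair E.ρbar₁ C₁ ν₁)
    (h₂ : IsTopEigenpair E.ρbar₂ C₂ ν₂) : E.W ν₁ ν₂ * (E.W ν₁ ν₂)ᴴ = E.ρ₀ := by
  rw [conjTranspose_W, W, Matrix.mul_assoc, ← Matrix.mul_assoc _ _ E.sqrtρ₀,
    colOp_mul_conjTranspose_colOp hne h₁ h₂, Matrix.one_mul, E.sqrtρ₀_mul_self]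

theorem isUnit_det_W (hne : E.ρ₁ ≠ E.ρ₂) (h₁ : IsTopEigenpair E.ρbar₁ C₁ ν₁)
    (h₂ : IsTopEigenpair E.ρbar₂ C₂ ν₂) : IsUnit (E.W ν₁ ν₂).det := by
  have h := (ρ₀_posDef hne).isUnit
  rw [Matrix.isUnit_iff_isUnit_det, ← W_mul_conjTranspose_W hne h₁ h₂, Matrix.det_mul] at h
  exact isUnit_of_mul_isUnit_left h

/-- The entry `1 - C₂` appears because `ν₂`, a top eigenvector of `ρbar₂`, is an eigenvector of
`ρbar₁ = 1 - ρbar₂`. -/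
theorem q₁_smul_ρ₁_eq (hne : E.ρ₁ ≠ E.ρ₂) (h₁ : IsTopEigenpair E.ρbar₁ C₁ ν₁)
    (h₂ : IsTopEigenpair E.ρbar₂ C₂ ν₂) : (E.q₁ : ℂ) • E.ρ₁ =
      E.W ν₁ ν₂ * !![(C₁ : ℂ), 0; 0, ((1 - C₂ : ℝ) : ℂ)] * (E.W ν₁ ν₂)ᴴ := by
  rw [conjTranspose_W, W,
    Matrix.mul_assoc E.sqrtρ₀, ← mul_colOp h₁.2.1 (ρbar₁_mulVec_of_ρbar₂ hne h₂.2.1),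
    ← Matrix.mul_assoc, Matrix.mul_assoc _ (_ * _), Matrix.mul_assoc E.ρbar₁,
    colOp_mul_conjTranspose_colOp hne h₁ h₂, Matrix.mul_one, sqrtρ₀_mul_ρbar₁_mul hne]

theorem q₂_smul_ρ₂_eq (hne : E.ρ₁ ≠ E.ρ₂) (h₁ : IsTopEigenpair E.ρbar₁ C₁ ν₁)
    (h₂ : IsTopEigenpair E.ρbar₂ C₂ ν₂) : (E.q₂ : ℂ) • E.ρ₂ =
      E.W ν₁ ν₂ * !![((1 - C₁ : ℝ) : ℂ), 0; 0, (C₂ : ℂ)] * (E.W ν₁ ν₂)ᴴ := by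
  have h : (E.q₂ : ℂ) • E.ρ₂ = E.ρ₀ - (E.q₁ : ℂ) • E.ρ₁ := by rw [ρ₀, add_sub_cancel_left]
  have hd : (!![((1 - C₁ : ℝ) : ℂ), 0; 0, (C₂ : ℂ)] : Op) =
      1 - !![(C₁ : ℂ), 0; 0, ((1 - C₂ : ℝ) : ℂ)] := by
    ext i j; fin_cases i <;> fin_cases j <;> simp
  rw [h, hd, Matrix.mul_sub, Matrix.sub_mul, Matrix.mul_one, W_mul_conjTranspose_W hne h₁ h₂,
    q₁_smul_ρ₁_eq hne h₁ h₂]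

theorem bar_eq_iff (hne : E.ρ₁ ≠ E.ρ₂) (h₁ : IsTopEigenpair E.ρbar₁ C₁ ν₁)
    (h₂ : IsTopEigenpair E.ρbar₂ C₂ ν₂) (M : Op) (a b c d : ℂ) :
    E.bar M = a • ketbra ν₁ ν₁ + b • ketbra ν₁ ν₂ + c • ketbra ν₂ ν₁ + d • ketbra ν₂ ν₂ ↔
      (E.W ν₁ ν₂)ᴴ * M * E.W ν₁ ν₂ = !![a, b; c, d] := by
  have hU := conjTranspose_colOp_mul_colOp hne h₁ h₂
  have hU' := colOp_mul_conjTranspose_colOp hne h₁ h₂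
  have e : (E.W ν₁ ν₂)ᴴ * M * E.W ν₁ ν₂ = (colOp ν₁ ν₂)ᴴ * E.bar M * colOp ν₁ ν₂ := by
    rw [conjTranspose_W, W, bar]
    simp only [Matrix.mul_assoc]
  rw [← colOp_mul_mul_conjTranspose, e]
  generalize E.bar M = B
  generalize colOp ν₁ ν₂ = U at *
  constructor
  · rintro rfl
    calc _ = Uᴴ * U * !![a, b; c, d] * (Uᴴ * U) := by simp only [Matrix.mul_assoc]
      _ = _ := by rw [hU, Matrix.one_mul, Matrix.mul_one]
  · intro h
    rw [← h]
    calc B = U * Uᴴ * B * (U * Uᴴ) := by rw [hU', Matrix.one_mul, Matrix.mul_one]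
      _ = _ := by simp only [Matrix.mul_assoc]

end Ensemble

/-! ### Optimality certified by a nonnegative loss. -/

namespace Ensemble

section Duality

variable {E : Ensemble} {q₀ V : ℝ} {loss : (Fin 3 → Op) → ℝ}

theorem probI_add_probC {M : Fin 3 → Op} (hM : IsPOVM M) : E.probI M + E.probC M = 1 := by
  have h : M 0 + M 1 + M 2 = 1 := by rw [← hM.2, Fin.sum_univ_three]
  have ht := congrArg (fun A => (E.ρ₀ * A).trace.re) h
  simp only [Matrix.mul_add, Matrix.trace_add, Complex.add_re, Matrix.mul_one, E.trace_ρ₀,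
    Complex.one_re] at ht
  rw [probI, probC, ← ht]
  ring

theorem mem_PI_iff (hV : ∀ M, IsPOVM M → E.modCor q₀ M = V - loss M)
    (h0 : ∀ M, IsPOVM M → 0 ≤ loss M) (hex : ∃ M, IsPOVM M ∧ loss M = 0) {Q : ℝ} :
    Q ∈ E.PI q₀ ↔ ∃ M, IsPOVM M ∧ E.probI M = Q ∧ loss M = 0 := by
  constructor
  · rintro ⟨M, ⟨hM, hopt⟩, hQ⟩
    obtain ⟨M', hM', hl⟩ := hex
    have h := hopt M' hM'
    rw [hV M hM, hV M' hM', hl] at h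
    exact ⟨M, hM, hQ, le_antisymm (by linarith) (h0 M hM)⟩
  · rintro ⟨M, hM, hQ, hl⟩
    refine ⟨M, ⟨hM, fun M' hM' => ?_⟩, hQ⟩
    rw [hV M hM, hV M' hM', hl]
    linarith [h0 M' hM']

/-- At fixed `P_I = Q` the term `q₀ Q` is constant, so maximizing `P_cor` amounts to minimizing the
loss. -/
theorem isFRIRMeasurement_iff (hV : ∀ M, IsPOVM M → E.modCor q₀ M = V - loss M)
    (h0 : ∀ M, IsPOVM M → 0 ≤ loss M) {Q : ℝ}
    (hex : ∃ M, IsPOVM M ∧ E.probI M = Q ∧ loss M = 0) (M : Fin 3 → Op) :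
    E.IsFRIRMeasurement Q M ↔ IsPOVM M ∧ E.probI M = Q ∧ loss M = 0 := by
  have key : ∀ M, IsPOVM M → E.probI M = Q → E.probCor M = V - q₀ * Q - loss M := by
    intro M hM hQ
    have := hV M hM
    rw [modCor, hQ] at this
    linarith
  constructor
  · rintro ⟨hM, hQ, hopt⟩
    obtain ⟨M', hM', hQ', hl⟩ := hex
    have h := hopt M' hM' hQ'
    rw [key M hM hQ, key M' hM' hQ', hl] at h
    exact ⟨hM, hQ, le_antisymm (by linarith) (h0 M hM)⟩
  · rintro ⟨hM, hQ, hl⟩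
    refine ⟨hM, hQ, fun M' hM' hQ' => ?_⟩
    rw [key M hM hQ, key M' hM' hQ', hl]
    linarith [h0 M' hM']

theorem isOptRate_of_loss (hV : ∀ M, IsPOVM M → E.modCor q₀ M = V - loss M)
    (h0 : ∀ M, IsPOVM M → 0 ≤ loss M) {Q : ℝ}
    (hex : ∃ M, IsPOVM M ∧ E.probI M = Q ∧ loss M = 0) (hQ1 : Q < 1) :
    E.IsOptRate Q ((V - q₀ * Q) / (1 - Q)) := by
  have key : ∀ M, IsPOVM M → E.probI M = Q →
      E.rateCor M = (V - q₀ * Q - loss M) / (1 - Q) := by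
    intro M hM hQ
    have h := hV M hM
    have h' := probI_add_probC (E := E) hM
    rw [modCor, hQ] at h
    rw [hQ] at h'
    rw [rateCor, eq_sub_of_add_eq' h', eq_sub_of_add_eq' h]
    ring
  constructor
  · obtain ⟨M, hM, hQ, hl⟩ := hex
    exact ⟨M, hM, hQ, by rw [key M hM hQ, hl, sub_zero]⟩
  · rintro _ ⟨M, hM, hQ, rfl⟩
    rw [key M hM hQ]
    exact div_le_div_of_nonneg_right (by linarith [h0 M hM]) (by linarith)

/-- The objective of a measurement with `P_I = 0` does not depend on `q`, so it stays at most `V`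
for every degree; any measurement exceeding `V` rules it out. -/
theorem isStartDegree_of_loss (hV : ∀ M, IsPOVM M → E.modCor q₀ M = V - loss M)
    (h0 : ∀ M, IsPOVM M → 0 ≤ loss M) (hq₀ : 0 < q₀) (hmem : 0 ∈ E.PI q₀)
    (hgt : ∀ q, q₀ < q → ∃ M, IsPOVM M ∧ V < E.modCor q M) : E.IsStartDegree q₀ := by
  refine ⟨⟨hq₀, hmem⟩, ?_⟩
  rintro q ⟨-, M, ⟨hM, hopt⟩, hI⟩
  by_contra hlt
  obtain ⟨M', hM', hV'⟩ := hgt q (not_le.1 hlt)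
  have h1 := hopt M' hM'
  have h2 := hV M hM
  rw [modCor.eq_def E q M, hI] at h1
  rw [modCor, hI] at h2
  linarith [h0 M hM]

/-- The objective of a zero-loss measurement equals `V` at `q₀` and grows in `q` with slope `P_I >
0`. -/
theorem isStartDegree_of_probI_pos (hV : ∀ M, IsPOVM M → E.modCor q₀ M = V - loss M)
    (h0 : ∀ M, IsPOVM M → 0 ≤ loss M) (hq₀ : 0 < q₀) (hmem : 0 ∈ E.PI q₀)
    (hex : ∃ M, IsPOVM M ∧ loss M = 0 ∧ 0 < E.probI M) : E.IsStartDegree q₀ := by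
  refine isStartDegree_of_loss hV h0 hq₀ hmem fun q hq => ?_
  obtain ⟨M, hM, hl, hI⟩ := hex
  refine ⟨M, hM, ?_⟩
  have := hV M hM
  rw [modCor] at this ⊢
  nlinarith

end Duality

/-! ### POVMs and probabilities in the coordinates given by `W`. -/

variable {E : Ensemble} {C₁ C₂ : ℝ} {ν₁ ν₂ : Fin 2 → ℂ}

/-- The congruence `M ↦ Wᴴ M W`, i.e. the matrix of `ρ₀^{1/2} M ρ₀^{1/2}` in the basis `ν₁, ν₂`. -/
noncomputable def barMat (E : Ensemble) (ν₁ ν₂ : Fin 2 → ℂ) (M : Op) : Op :=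
  (E.W ν₁ ν₂)ᴴ * M * E.W ν₁ ν₂

theorem barMat_add (A B : Op) :
    E.barMat ν₁ ν₂ (A + B) = E.barMat ν₁ ν₂ A + E.barMat ν₁ ν₂ B := by
  simp only [barMat, Matrix.mul_add, Matrix.add_mul]

theorem barMat_conj_inv (hW : IsUnit (E.W ν₁ ν₂).det) (N : Op) :
    E.barMat ν₁ ν₂ ((E.W ν₁ ν₂)⁻¹ᴴ * N * (E.W ν₁ ν₂)⁻¹) = N := by
  rw [barMat]
  calc _ = ((E.W ν₁ ν₂)⁻¹ * E.W ν₁ ν₂)ᴴ * N * ((E.W ν₁ ν₂)⁻¹ * E.W ν₁ ν₂) := by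
        simp only [Matrix.conjTranspose_mul, Matrix.mul_assoc]
    _ = N := by rw [Matrix.nonsing_inv_mul _ hW]; simp

theorem conj_inv_barMat (hW : IsUnit (E.W ν₁ ν₂).det) (M : Op) :
    (E.W ν₁ ν₂)⁻¹ᴴ * E.barMat ν₁ ν₂ M * (E.W ν₁ ν₂)⁻¹ = M := by
  rw [barMat]
  calc _ = (E.W ν₁ ν₂ * (E.W ν₁ ν₂)⁻¹)ᴴ * M * (E.W ν₁ ν₂ * (E.W ν₁ ν₂)⁻¹) := by
        simp only [Matrix.conjTranspose_mul, Matrix.mul_assoc]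
    _ = M := by rw [Matrix.mul_nonsing_inv _ hW]; simp

theorem posSemidef_barMat_iff (hW : IsUnit (E.W ν₁ ν₂).det) {M : Op} :
    (E.barMat ν₁ ν₂ M).PosSemidef ↔ M.PosSemidef := by
  constructor
  · intro h
    rw [← conj_inv_barMat hW M]
    exact h.conjTranspose_mul_mul_same _
  · exact fun h => h.conjTranspose_mul_mul_same _

theorem isPOVM_iff_barMat (hW : IsUnit (E.W ν₁ ν₂).det) {M : Fin 3 → Op} :
    IsPOVM M ↔ (∀ i, (E.barMat ν₁ ν₂ (M i)).PosSemidef) ∧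
      E.barMat ν₁ ν₂ (M 0) + E.barMat ν₁ ν₂ (M 1) + E.barMat ν₁ ν₂ (M 2) =
        (E.W ν₁ ν₂)ᴴ * E.W ν₁ ν₂ := by
  have h1 : (E.W ν₁ ν₂)ᴴ * E.W ν₁ ν₂ = E.barMat ν₁ ν₂ 1 := by rw [barMat, Matrix.mul_one]
  simp only [IsPOVM, posSemidef_barMat_iff hW, Fin.sum_univ_three, ← barMat_add, h1]
  refine and_congr_right fun _ => ⟨fun h => by rw [h], fun h => ?_⟩
  rw [← conj_inv_barMat hW (M 0 + M 1 + M 2), h, conj_inv_barMat hW]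

theorem exists_barMat_eq (hW : IsUnit (E.W ν₁ ν₂).det) (N₀ N₁ N₂ : Op) :
    ∃ M : Fin 3 → Op, E.barMat ν₁ ν₂ (M 0) = N₀ ∧ E.barMat ν₁ ν₂ (M 1) = N₁ ∧
      E.barMat ν₁ ν₂ (M 2) = N₂ :=
  ⟨fun i => (E.W ν₁ ν₂)⁻¹ᴴ * (![N₀, N₁, N₂] i) * (E.W ν₁ ν₂)⁻¹,
    barMat_conj_inv hW _, barMat_conj_inv hW _, barMat_conj_inv hW _⟩

theorem trace_conj_mul (D M : Op) :
    (E.W ν₁ ν₂ * D * (E.W ν₁ ν₂)ᴴ * M).trace = (D * E.barMat ν₁ ν₂ M).trace := by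
  rw [barMat, Matrix.mul_assoc, Matrix.mul_assoc, Matrix.trace_mul_comm]
  simp only [Matrix.mul_assoc]

theorem trace_diagonal_mul_fin_two (a b : ℂ) (N : Op) :
    (!![a, 0; 0, b] * N).trace = a * N 0 0 + b * N 1 1 := by
  simp [Matrix.trace_fin_two, vecMul, dotProduct, Fin.sum_univ_two]

theorem probI_eq (hne : E.ρ₁ ≠ E.ρ₂) (h₁ : IsTopEigenpair E.ρbar₁ C₁ ν₁)
    (h₂ : IsTopEigenpair E.ρbar₂ C₂ ν₂) (M : Fin 3 → Op) :
    E.probI M = (E.barMat ν₁ ν₂ (M 0) 0 0).re + (E.barMat ν₁ ν₂ (M 0) 1 1).re := by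
  have h := trace_conj_mul (E := E) (ν₁ := ν₁) (ν₂ := ν₂) 1 (M 0)
  rw [Matrix.mul_one, W_mul_conjTranspose_W hne h₁ h₂, Matrix.one_mul] at h
  rw [probI, h, Matrix.trace_fin_two, Complex.add_re]

theorem probCor_eq (hne : E.ρ₁ ≠ E.ρ₂) (h₁ : IsTopEigenpair E.ρbar₁ C₁ ν₁)
    (h₂ : IsTopEigenpair E.ρbar₂ C₂ ν₂) (M : Fin 3 → Op) :
    E.probCor M = C₁ * (E.barMat ν₁ ν₂ (M 1) 0 0).re + (1 - C₂) * (E.barMat ν₁ ν₂ (M 1) 1 1).re +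
      (1 - C₁) * (E.barMat ν₁ ν₂ (M 2) 0 0).re + C₂ * (E.barMat ν₁ ν₂ (M 2) 1 1).re := by
  have e₁ : E.q₁ * ((E.ρ₁ * M 1).trace).re = (((E.q₁ : ℂ) • E.ρ₁) * M 1).trace.re := by
    rw [Matrix.smul_mul, Matrix.trace_smul, smul_eq_mul, Complex.re_ofReal_mul]
  have e₂ : E.q₂ * ((E.ρ₂ * M 2).trace).re = (((E.q₂ : ℂ) • E.ρ₂) * M 2).trace.re := by
    rw [Matrix.smul_mul, Matrix.trace_smul, smul_eq_mul, Complex.re_ofReal_mul]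
  rw [probCor, e₁, e₂, q₁_smul_ρ₁_eq hne h₁ h₂, q₂_smul_ρ₂_eq hne h₁ h₂, trace_conj_mul,
    trace_conj_mul]
  simp only [trace_diagonal_mul_fin_two, Complex.add_re, Complex.re_ofReal_mul]
  ring

/-- `ρ_ij = ⟨ν_i|ρ₀|ν_j⟩` are the entries of a positive definite matrix of unit trace. -/
structure IsGram (E : Ensemble) (ν₁ ν₂ : Fin 2 → ℂ) (r₁₁ r₂₂ : ℝ) (r₁₂ r₂₁ : ℂ) : Prop where
  gram : (E.W ν₁ ν₂)ᴴ * E.W ν₁ ν₂ = !![(r₁₁ : ℂ), r₁₂; r₂₁, (r₂₂ : ℂ)]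
  star_eq : r₂₁ = star r₁₂
  pos₁ : 0 < r₁₁
  pos₂ : 0 < r₂₂
  norm_sq_lt : ‖r₁₂‖ ^ 2 < r₁₁ * r₂₂
  add_eq_one : r₁₁ + r₂₂ = 1

theorem isGram (hne : E.ρ₁ ≠ E.ρ₂) (h₁ : IsTopEigenpair E.ρbar₁ C₁ ν₁)
    (h₂ : IsTopEigenpair E.ρbar₂ C₂ ν₂) {r₁₁ r₂₂ : ℝ} {r₁₂ r₂₁ : ℂ}
    (hr₁₁ : r₁₁ = (braket ν₁ E.ρ₀ ν₁).re) (hr₂₂ : r₂₂ = (braket ν₂ E.ρ₀ ν₂).re)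
    (hr₁₂ : r₁₂ = braket ν₁ E.ρ₀ ν₂) (hr₂₁ : r₂₁ = braket ν₂ E.ρ₀ ν₁) :
    E.IsGram ν₁ ν₂ r₁₁ r₂₂ r₁₂ r₂₁ := by
  have hW := isUnit_det_W hne h₁ h₂
  have hps := Matrix.posSemidef_conjTranspose_mul_self (E.W ν₁ ν₂)
  have hpd : ((E.W ν₁ ν₂)ᴴ * E.W ν₁ ν₂).PosDef := by
    rw [hps.posDef_iff_det_ne_zero, Matrix.det_mul, Matrix.det_conjTranspose]
    exact mul_ne_zero (star_ne_zero.2 hW.ne_zero) hW.ne_zero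
  -- By cyclicity this is the trace of `W Wᴴ = ρ₀`.
  have htr : ((E.W ν₁ ν₂)ᴴ * E.W ν₁ ν₂).trace = 1 := by
    rw [Matrix.trace_mul_comm, W_mul_conjTranspose_W hne h₁ h₂, E.trace_ρ₀]
  have hG := E.conjTranspose_W_mul_W ν₁ ν₂
  rw [← hr₁₂, ← hr₂₁] at hG
  have d₁ := diag_eq_re hps 0
  have d₂ := diag_eq_re hps 1
  have hs := hps.isHermitian.apply 1 0
  have p₁ := (Complex.lt_def.1 (hpd.diag_pos (i := 0))).1
  have p₂ := (Complex.lt_def.1 (hpd.diag_pos (i := 1))).1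
  have hdet := (Complex.lt_def.1 hpd.det_pos).1
  rw [hG] at d₁ d₂ hs p₁ p₂ hdet htr
  simp only [Matrix.of_apply, Matrix.cons_val_zero, Matrix.cons_val_one,
    Matrix.cons_val_fin_one, Matrix.cons_val'] at d₁ d₂ hs p₁ p₂
  rw [← hr₁₁] at d₁ p₁
  rw [← hr₂₂] at d₂ p₂
  rw [d₁, d₂] at hG hdet htr
  rw [Matrix.det_fin_two_of, ← hs, RCLike.star_def, Complex.mul_conj] at hdet
  rw [Matrix.trace_fin_two_of] at htr
  refine ⟨hG, hs.symm, by simpa using p₁, by simpa using p₂, ?_, by exact_mod_cast htr⟩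
  rw [Complex.sq_norm]
  simpa [← Complex.ofReal_mul] using hdet

end Ensemble

/-! ### The case `C₁ ≤ 1/2`. -/

namespace Ensemble

variable {E : Ensemble} {C₁ C₂ : ℝ} {ν₁ ν₂ : Fin 2 → ℂ} {r₁₁ r₂₂ : ℝ} {r₁₂ r₂₁ : ℂ}

theorem re_sum_barMat (hW : IsUnit (E.W ν₁ ν₂).det) (hG : E.IsGram ν₁ ν₂ r₁₁ r₂₂ r₁₂ r₂₁)
    {M : Fin 3 → Op} (hM : IsPOVM M) :
    (E.barMat ν₁ ν₂ (M 0) 0 0).re + (E.barMat ν₁ ν₂ (M 1) 0 0).re +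
        (E.barMat ν₁ ν₂ (M 2) 0 0).re = r₁₁ ∧
      (E.barMat ν₁ ν₂ (M 0) 1 1).re + (E.barMat ν₁ ν₂ (M 1) 1 1).re +
        (E.barMat ν₁ ν₂ (M 2) 1 1).re = r₂₂ := by
  have h := ((isPOVM_iff_barMat hW).1 hM).2
  rw [hG.gram] at h
  have e₁ := congrArg (fun A : Op => (A 0 0).re) h
  have e₂ := congrArg (fun A : Op => (A 1 1).re) h
  simp only [Matrix.add_apply, Complex.add_re] at e₁ e₂
  exact ⟨by simpa using e₁, by simpa using e₂⟩

theorem re_diag_barMat_nonneg {M : Fin 3 → Op} (hM : IsPOVM M) (i : Fin 3) (j : Fin 2) :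
    0 ≤ (E.barMat ν₁ ν₂ (M i) j j).re :=
  re_diag_nonneg ((hM.1 i).conjTranspose_mul_mul_same _) j

/-- The right side is the Schur complement of `r₂₂` in the Gram matrix: the most weight on `ν₁` that
can be removed while keeping it positive semidefinite. -/
theorem one_sub_Q₂ (hG : E.IsGram ν₁ ν₂ r₁₁ r₂₂ r₁₂ r₂₁)
    (hr₂₂ : r₂₂ = (braket ν₂ E.ρ₀ ν₂).re) (hr₁₂ : r₁₂ = braket ν₁ E.ρ₀ ν₂) :
    1 - E.Q₂ ν₁ ν₂ = r₁₁ - ‖r₁₂‖ ^ 2 / r₂₂ := by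
  rw [Q₂, ← hr₂₂, ← hr₁₂, ← hG.add_eq_one]
  ring

/-- The gap between `V` and `(1 - C₁) P_I + P_cor`. -/
noncomputable def lossMixed (E : Ensemble) (C₁ C₂ : ℝ) (ν₁ ν₂ : Fin 2 → ℂ) (M : Fin 3 → Op) : ℝ :=
  (1 - 2 * C₁) * (E.barMat ν₁ ν₂ (M 1) 0 0).re +
    (C₁ + C₂ - 1) * (E.barMat ν₁ ν₂ (M 0) 1 1).re +
    (2 * C₂ - 1) * (E.barMat ν₁ ν₂ (M 1) 1 1).re

theorem modCor_eq_sub_lossMixed (hne : E.ρ₁ ≠ E.ρ₂) (h₁ : IsTopEigenpair E.ρbar₁ C₁ ν₁)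
    (h₂ : IsTopEigenpair E.ρbar₂ C₂ ν₂) (hG : E.IsGram ν₁ ν₂ r₁₁ r₂₂ r₁₂ r₂₁) (M : Fin 3 → Op)
    (hM : IsPOVM M) :
    E.modCor (1 - C₁) M = (1 - C₁) * r₁₁ + C₂ * r₂₂ - E.lossMixed C₁ C₂ ν₁ ν₂ M := by
  obtain ⟨e₁, e₂⟩ := re_sum_barMat (isUnit_det_W hne h₁ h₂) hG hM
  rw [modCor, probI_eq hne h₁ h₂, probCor_eq hne h₁ h₂, lossMixed, ← e₁, ← e₂]
  ring

theorem lossMixed_nonneg (hle : C₁ ≤ 1 / 2) (hsum : 1 < C₁ + C₂)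
    (M : Fin 3 → Op) (hM : IsPOVM M) : 0 ≤ E.lossMixed C₁ C₂ ν₁ ν₂ M := by
  have a := re_diag_barMat_nonneg (E := E) (ν₁ := ν₁) (ν₂ := ν₂) hM 1 0
  have b := re_diag_barMat_nonneg (E := E) (ν₁ := ν₁) (ν₂ := ν₂) hM 0 1
  have c := re_diag_barMat_nonneg (E := E) (ν₁ := ν₁) (ν₂ := ν₂) hM 1 1
  exact add_nonneg (add_nonneg (mul_nonneg (by linarith) a) (mul_nonneg (by linarith) b))
    (mul_nonneg (by linarith) c)

/-- Both sides are the trace of `q₂ ρ₂`, the success probability of always guessing the second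
state. -/
theorem value_mixed (hne : E.ρ₁ ≠ E.ρ₂) (h₁ : IsTopEigenpair E.ρbar₁ C₁ ν₁)
    (h₂ : IsTopEigenpair E.ρbar₂ C₂ ν₂) (hG : E.IsGram ν₁ ν₂ r₁₁ r₂₂ r₁₂ r₂₁) :
    (1 - C₁) * r₁₁ + C₂ * r₂₂ = 1 - E.q₁ := by
  have h := congrArg Matrix.trace (q₂_smul_ρ₂_eq hne h₁ h₂)
  rw [Matrix.trace_smul, E.ρ₂_density.2, Matrix.mul_assoc, Matrix.trace_mul_comm,
    Matrix.mul_assoc, hG.gram, trace_diagonal_mul_fin_two] at h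
  have h' := congrArg Complex.re h
  simp at h'
  linarith [E.q_sum]

/-- The measurements that attain the bound in the case `C₁ ≤ 1/2`. -/
theorem lossMixed_eq_zero_iff (hW : IsUnit (E.W ν₁ ν₂).det)
    (hI : ∀ M, E.probI M = (E.barMat ν₁ ν₂ (M 0) 0 0).re + (E.barMat ν₁ ν₂ (M 0) 1 1).re)
    (hG : E.IsGram ν₁ ν₂ r₁₁ r₂₂ r₁₂ r₂₁)
    (hle : C₁ ≤ 1 / 2) (hsum : 1 < C₁ + C₂) (Q : ℝ) (M : Fin 3 → Op) :
    (IsPOVM M ∧ E.probI M = Q ∧ E.lossMixed C₁ C₂ ν₁ ν₂ M = 0) ↔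
      0 ≤ Q ∧ ∃ ε : ℝ, (0 ≤ ε ∧ (C₁ < 1 / 2 → ε = 0) ∧ ε ≤ r₁₁ - ‖r₁₂‖ ^ 2 / r₂₂ - Q) ∧
        E.barMat ν₁ ν₂ (M 0) = !![(Q : ℂ), 0; 0, 0] ∧
        E.barMat ν₁ ν₂ (M 1) = !![(ε : ℂ), 0; 0, 0] ∧
        E.barMat ν₁ ν₂ (M 2) = !![((r₁₁ - Q - ε : ℝ) : ℂ), r₁₂; r₂₁, (r₂₂ : ℂ)] := by
  constructor
  · rintro ⟨hM, hQ, hl⟩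
    obtain ⟨hps, hs⟩ := (isPOVM_iff_barMat hW).1 hM
    have a := re_diag_nonneg (hps 1) 0
    have b := re_diag_nonneg (hps 0) 1
    have c := re_diag_nonneg (hps 1) 1
    have t₁ := mul_nonneg (by linarith : 0 ≤ 1 - 2 * C₁) a
    have t₂ := mul_nonneg (by linarith : 0 ≤ C₁ + C₂ - 1) b
    have t₃ := mul_nonneg (by linarith : 0 ≤ 2 * C₂ - 1) c
    rw [lossMixed] at hl
    have b0 : (E.barMat ν₁ ν₂ (M 0) 1 1).re = 0 :=
      (mul_eq_zero.1 (by linarith : (C₁ + C₂ - 1) * (E.barMat ν₁ ν₂ (M 0) 1 1).re = 0)).resolve_left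
        (by linarith)
    have c0 : (E.barMat ν₁ ν₂ (M 1) 1 1).re = 0 :=
      (mul_eq_zero.1 (by linarith : (2 * C₂ - 1) * (E.barMat ν₁ ν₂ (M 1) 1 1).re = 0)).resolve_left
        (by linarith)
    have hQ' : (E.barMat ν₁ ν₂ (M 0) 0 0).re = Q := by rw [← hQ, hI, b0, add_zero]
    have N0 := eq_of_re_one_one (hps 0) b0
    have N1 := eq_of_re_one_one (hps 1) c0
    rw [hQ'] at N0
    have N2 : E.barMat ν₁ ν₂ (M 2) =
        !![((r₁₁ - Q - (E.barMat ν₁ ν₂ (M 1) 0 0).re : ℝ) : ℂ), r₁₂; r₂₁, (r₂₂ : ℂ)] := by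
      rw [eq_sub_of_add_eq' hs, hG.gram, N0]
      nth_rewrite 1 [N1]
      ext i j
      fin_cases i <;> fin_cases j <;> simp
      ring
    refine ⟨hQ' ▸ re_diag_nonneg (hps 0) 0, _, ⟨a, fun hlt => ?_, ?_⟩, N0, N1, N2⟩
    · exact (mul_eq_zero.1
        (by linarith : (1 - 2 * C₁) * (E.barMat ν₁ ν₂ (M 1) 0 0).re = 0)).resolve_left
        (by linarith)
    -- The remainder assigned to outcome 2 must be positive semidefinite; its determinant condition
    -- is the upper bound on `ε`.
    · have hn := norm_sq_le_of_posSemidef (hps 2)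
      rw [N2] at hn
      simp only [Matrix.of_apply, Matrix.cons_val_zero, Matrix.cons_val_one, Matrix.cons_val_fin_one,
        Matrix.cons_val', Complex.ofReal_re] at hn
      rw [← div_le_iff₀ hG.pos₂] at hn
      linarith
  · rintro ⟨hQ0, ε, ⟨hε, hεz, hεle⟩, N0, N1, N2⟩
    refine ⟨(isPOVM_iff_barMat hW).2 ⟨fun i => ?_, ?_⟩, ?_, ?_⟩
    · fin_cases i
      · change (E.barMat ν₁ ν₂ (M 0)).PosSemidef
        rw [N0]
        simpa using posSemidef_diagonal_two hQ0 le_rfl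
      · change (E.barMat ν₁ ν₂ (M 1)).PosSemidef
        rw [N1]
        simpa using posSemidef_diagonal_two hε le_rfl
      · change (E.barMat ν₁ ν₂ (M 2)).PosSemidef
        rw [N2]
        refine posSemidef_fin_two hG.pos₂ hG.star_eq ?_
        rw [← div_le_iff₀ hG.pos₂]
        linarith
    · rw [N0, N1, N2, hG.gram]
      ext i j
      fin_cases i <;> fin_cases j <;> simp
    · rw [hI, N0]
      simp
    · rw [lossMixed, N0, N1]
      simp
      -- Either `ε = 0`, or `C₁ = 1/2` and the coefficient `1 - 2 C₁` vanishes; this is why `ε`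
      -- becomes free at equality.
      rcases hle.lt_or_eq with h | h
      · exact Or.inr (hεz h)
      · exact Or.inl (by rw [h]; norm_num)

theorem bar_eq_diag₁ (hne : E.ρ₁ ≠ E.ρ₂) (h₁ : IsTopEigenpair E.ρbar₁ C₁ ν₁)
    (h₂ : IsTopEigenpair E.ρbar₂ C₂ ν₂) (M : Op) (a : ℂ) :
    E.bar M = a • ketbra ν₁ ν₁ ↔ E.barMat ν₁ ν₂ M = !![a, 0; 0, 0] := by
  have := bar_eq_iff hne h₁ h₂ M a 0 0 0
  simpa only [zero_smul, add_zero, barMat] using this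

theorem bar_eq_diag₂ (hne : E.ρ₁ ≠ E.ρ₂) (h₁ : IsTopEigenpair E.ρbar₁ C₁ ν₁)
    (h₂ : IsTopEigenpair E.ρbar₂ C₂ ν₂) (M : Op) (d : ℂ) :
    E.bar M = d • ketbra ν₂ ν₂ ↔ E.barMat ν₁ ν₂ M = !![0, 0; 0, d] := by
  have := bar_eq_iff hne h₁ h₂ M 0 0 0 d
  simpa only [zero_smul, add_zero, zero_add, barMat] using this

theorem bar_eq_diag (hne : E.ρ₁ ≠ E.ρ₂) (h₁ : IsTopEigenpair E.ρbar₁ C₁ ν₁)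
    (h₂ : IsTopEigenpair E.ρbar₂ C₂ ν₂) (M : Op) (a d : ℂ) :
    E.bar M = a • ketbra ν₁ ν₁ + d • ketbra ν₂ ν₂ ↔
      E.barMat ν₁ ν₂ M = !![a, 0; 0, d] := by
  have := bar_eq_iff hne h₁ h₂ M a 0 0 d
  simpa only [zero_smul, add_zero, zero_add, barMat] using this

theorem frir_of_le_half (hne : E.ρ₁ ≠ E.ρ₂) (h₁ : IsTopEigenpair E.ρbar₁ C₁ ν₁)
    (h₂ : IsTopEigenpair E.ρbar₂ C₂ ν₂)
    (hr₁₁ : r₁₁ = (braket ν₁ E.ρ₀ ν₁).re) (hr₂₂ : r₂₂ = (braket ν₂ E.ρ₀ ν₂).re)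
    (hr₁₂ : r₁₂ = braket ν₁ E.ρ₀ ν₂) (hr₂₁ : r₂₁ = braket ν₂ E.ρ₀ ν₁)
    (hle : C₁ ≤ 1 / 2) :
    E.IsStartDegree (1 - C₁) ∧
      E.PI (1 - C₁) = Set.Icc 0 (1 - E.Q₂ ν₁ ν₂) ∧
      ∀ Q ∈ E.PI (1 - C₁),
        E.IsOptRate Q (1 - C₁ + (C₁ - E.q₁) / (1 - Q)) ∧
        ∀ M : Fin 3 → Op, E.IsFRIRMeasurement Q M ↔
          ∃ ε : ℝ,
            ((C₁ < 1 / 2 → ε = 0) ∧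
              (C₁ = 1 / 2 → 0 ≤ ε ∧ ε ≤ 1 - E.Q₂ ν₁ ν₂ - Q)) ∧
            E.bar (M 0) = (Q : ℂ) • ketbra ν₁ ν₁ ∧
            E.bar (M 1) = (ε : ℂ) • ketbra ν₁ ν₁ ∧
            E.bar (M 2) = ((r₁₁ - Q - ε : ℝ) : ℂ) • ketbra ν₁ ν₁ +
              r₁₂ • ketbra ν₁ ν₂ + r₂₁ • ketbra ν₂ ν₁ +
              (r₂₂ : ℂ) • ketbra ν₂ ν₂ := by
  have hG := isGram hne h₁ h₂ hr₁₁ hr₂₂ hr₁₂ hr₂₁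
  have hW := isUnit_det_W hne h₁ h₂
  have hsum := one_lt_add hne h₁ h₂
  have hV := modCor_eq_sub_lossMixed hne h₁ h₂ hG
  have h0 := lossMixed_nonneg (E := E) (ν₁ := ν₁) (ν₂ := ν₂) hle hsum
  have hiff := lossMixed_eq_zero_iff hW (probI_eq hne h₁ h₂) hG hle hsum
  have hQ₂ := one_sub_Q₂ hG hr₂₂ hr₁₂
  have hpos : 0 < 1 - E.Q₂ ν₁ ν₂ := by
    rw [hQ₂, sub_pos, div_lt_iff₀ hG.pos₂]
    exact hG.norm_sq_lt
  have hlt1 : 1 - E.Q₂ ν₁ ν₂ < 1 := by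
    rw [hQ₂]
    have : 0 ≤ ‖r₁₂‖ ^ 2 / r₂₂ := div_nonneg (sq_nonneg _) hG.pos₂.le
    linarith [hG.add_eq_one, hG.pos₂]
  rw [value_mixed hne h₁ h₂ hG] at hV
  have hex : ∀ Q, 0 ≤ Q → Q ≤ 1 - E.Q₂ ν₁ ν₂ →
      ∃ M, IsPOVM M ∧ E.probI M = Q ∧ E.lossMixed C₁ C₂ ν₁ ν₂ M = 0 := by
    intro Q hQ hQ'
    -- The choice `ε = 0` is admissible both for `C₁ < 1/2` and for `C₁ = 1/2`.
    obtain ⟨M, N0, N1, N2⟩ := exists_barMat_eq hW (!![(Q : ℂ), 0; 0, 0]) (!![((0 : ℝ) : ℂ), 0; 0, 0])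
      (!![((r₁₁ - Q - 0 : ℝ) : ℂ), r₁₂; r₂₁, (r₂₂ : ℂ)])
    exact ⟨M, (hiff Q M).2 ⟨hQ, 0, ⟨le_rfl, fun _ => rfl, by linarith⟩, N0, N1, N2⟩⟩
  have hex0 : ∃ M, IsPOVM M ∧ E.lossMixed C₁ C₂ ν₁ ν₂ M = 0 := by
    obtain ⟨M, hM, -, hl⟩ := hex 0 le_rfl hpos.le
    exact ⟨M, hM, hl⟩
  have hPI : E.PI (1 - C₁) = Set.Icc 0 (1 - E.Q₂ ν₁ ν₂) := by
    ext Q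
    rw [mem_PI_iff hV h0 hex0]
    refine ⟨?_, fun h => hex Q h.1 h.2⟩
    rintro ⟨M, h⟩
    obtain ⟨hQ, ε, ⟨hε, -, hε'⟩, -⟩ := (hiff Q M).1 h
    exact ⟨hQ, by linarith⟩
  refine ⟨isStartDegree_of_probI_pos hV h0 (by linarith) (hPI ▸ ⟨le_rfl, hpos.le⟩) ?_, hPI, ?_⟩
  · obtain ⟨M, hM, hI, hl⟩ := hex _ hpos.le le_rfl
    exact ⟨M, hM, hl, hI ▸ hpos⟩
  · intro Q hQ
    rw [hPI] at hQ
    have hQ1 : Q < 1 := by linarith [hQ.2]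
    constructor
    · have e : 1 - C₁ + (C₁ - E.q₁) / (1 - Q) = (1 - E.q₁ - (1 - C₁) * Q) / (1 - Q) := by
        have : 1 - Q ≠ 0 := by linarith
        field_simp
        ring
      rw [e]
      exact isOptRate_of_loss hV h0 (hex Q hQ.1 hQ.2) hQ1
    · intro M
      rw [isFRIRMeasurement_iff hV h0 (hex Q hQ.1 hQ.2), hiff]
      simp only [bar_eq_iff hne h₁ h₂, bar_eq_diag₁ hne h₁ h₂, hQ₂]
      rw [hQ₂] at hQ
      constructor
      · rintro ⟨-, ε, ⟨hε, hz, hε'⟩, h⟩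
        exact ⟨ε, ⟨hz, fun _ => ⟨hε, hε'⟩⟩, h⟩
      · rintro ⟨ε, ⟨hz, hh⟩, h⟩
        refine ⟨hQ.1, ε, ?_, h⟩
        -- For `C₁ < 1/2` the range condition on `ε = 0` is not part of the hypothesis and comes
        -- from the upper bound on `Q`.
        rcases hle.lt_or_eq with hlt | heq
        · rw [hz hlt]
          exact ⟨le_rfl, fun _ => rfl, by linarith [hQ.2]⟩
        · exact ⟨(hh heq).1, hz, (hh heq).2⟩

/-! ### The case `1/2 < C₁` with `ρ₁₂ = 0`. -/

/-- The gap between `V` and `C₁ P_I + P_cor`. -/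
noncomputable def lossCommuting (E : Ensemble) (C₁ C₂ : ℝ) (ν₁ ν₂ : Fin 2 → ℂ)
    (M : Fin 3 → Op) : ℝ :=
  (2 * C₁ - 1) * (E.barMat ν₁ ν₂ (M 2) 0 0).re +
    (2 * C₂ - 1) * (E.barMat ν₁ ν₂ (M 1) 1 1).re +
    (C₂ - C₁) * (E.barMat ν₁ ν₂ (M 0) 1 1).re

theorem modCor_eq_sub_lossCommuting (hne : E.ρ₁ ≠ E.ρ₂) (h₁ : IsTopEigenpair E.ρbar₁ C₁ ν₁)
    (h₂ : IsTopEigenpair E.ρbar₂ C₂ ν₂) (hG : E.IsGram ν₁ ν₂ r₁₁ r₂₂ r₁₂ r₂₁) (M : Fin 3 → Op)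
    (hM : IsPOVM M) :
    E.modCor C₁ M = C₁ * r₁₁ + C₂ * r₂₂ - E.lossCommuting C₁ C₂ ν₁ ν₂ M := by
  obtain ⟨e₁, e₂⟩ := re_sum_barMat (isUnit_det_W hne h₁ h₂) hG hM
  rw [modCor, probI_eq hne h₁ h₂, probCor_eq hne h₁ h₂, lossCommuting, ← e₁, ← e₂]
  ring

theorem lossCommuting_nonneg (hlt : 1 / 2 < C₁) (hC : C₁ ≤ C₂)
    (M : Fin 3 → Op) (hM : IsPOVM M) : 0 ≤ E.lossCommuting C₁ C₂ ν₁ ν₂ M := by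
  have a := re_diag_barMat_nonneg (E := E) (ν₁ := ν₁) (ν₂ := ν₂) hM 2 0
  have b := re_diag_barMat_nonneg (E := E) (ν₁ := ν₁) (ν₂ := ν₂) hM 1 1
  have c := re_diag_barMat_nonneg (E := E) (ν₁ := ν₁) (ν₂ := ν₂) hM 0 1
  exact add_nonneg (add_nonneg (mul_nonneg (by linarith) a) (mul_nonneg (by linarith) b))
    (mul_nonneg (by linarith) c)

/-- The measurements that attain the bound in the case `1/2 < C₁`, `ρ₁₂ = 0`. -/
theorem lossCommuting_eq_zero_iff (hW : IsUnit (E.W ν₁ ν₂).det)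
    (hI : ∀ M, E.probI M = (E.barMat ν₁ ν₂ (M 0) 0 0).re + (E.barMat ν₁ ν₂ (M 0) 1 1).re)
    (hG : E.IsGram ν₁ ν₂ r₁₁ r₂₂ 0 r₂₁)
    (hlt : 1 / 2 < C₁) (hC : C₁ ≤ C₂) (Q : ℝ) (M : Fin 3 → Op) :
    (IsPOVM M ∧ E.probI M = Q ∧ E.lossCommuting C₁ C₂ ν₁ ν₂ M = 0) ↔
      ∃ ε : ℝ, ((C₁ < C₂ → ε = 0) ∧ max 0 (Q - r₁₁) ≤ ε ∧ ε ≤ min r₂₂ Q) ∧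
        E.barMat ν₁ ν₂ (M 0) = !![((Q - ε : ℝ) : ℂ), 0; 0, (ε : ℂ)] ∧
        E.barMat ν₁ ν₂ (M 1) = !![((r₁₁ - Q + ε : ℝ) : ℂ), 0; 0, 0] ∧
        E.barMat ν₁ ν₂ (M 2) = !![0, 0; 0, ((r₂₂ - ε : ℝ) : ℂ)] := by
  have h21 : r₂₁ = 0 := by rw [hG.star_eq, star_zero]
  subst h21
  constructor
  · rintro ⟨hM, hQ, hl⟩
    obtain ⟨hps, hs⟩ := (isPOVM_iff_barMat hW).1 hM
    obtain ⟨e₁, e₂⟩ := re_sum_barMat hW hG hM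
    have a := re_diag_nonneg (hps 2) 0
    have b := re_diag_nonneg (hps 1) 1
    have c := re_diag_nonneg (hps 0) 1
    have a' := re_diag_nonneg (hps 2) 1
    have b' := re_diag_nonneg (hps 1) 0
    have c' := re_diag_nonneg (hps 0) 0
    have t₁ := mul_nonneg (by linarith : 0 ≤ 2 * C₁ - 1) a
    have t₂ := mul_nonneg (by linarith : 0 ≤ 2 * C₂ - 1) b
    have t₃ := mul_nonneg (by linarith : 0 ≤ C₂ - C₁) c
    rw [lossCommuting] at hl
    have a0 : (E.barMat ν₁ ν₂ (M 2) 0 0).re = 0 :=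
      (mul_eq_zero.1 (by linarith : (2 * C₁ - 1) * (E.barMat ν₁ ν₂ (M 2) 0 0).re = 0)).resolve_left
        (by linarith)
    have b0 : (E.barMat ν₁ ν₂ (M 1) 1 1).re = 0 :=
      (mul_eq_zero.1 (by linarith : (2 * C₂ - 1) * (E.barMat ν₁ ν₂ (M 1) 1 1).re = 0)).resolve_left
        (by linarith)
    rw [hI] at hQ
    rw [a0, add_zero] at e₁
    rw [b0, add_zero] at e₂
    have N1 := eq_of_re_one_one (hps 1) b0
    have N2 := eq_of_re_zero_zero (hps 2) a0
    -- Outcomes 1 and 2 are diagonal, and so is the Gram matrix since `ρ₁₂ = 0`; completeness then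
    -- makes outcome 0 diagonal too.
    have N0 := hs
    rw [add_assoc, N1, N2, hG.gram, ← eq_sub_iff_add_eq] at N0
    rw [(by linarith : (E.barMat ν₁ ν₂ (M 1) 0 0).re = r₁₁ - Q + (E.barMat ν₁ ν₂ (M 0) 1 1).re)]
      at N0 N1
    rw [(by linarith : (E.barMat ν₁ ν₂ (M 2) 1 1).re = r₂₂ - (E.barMat ν₁ ν₂ (M 0) 1 1).re)]
      at N0 N2
    refine ⟨(E.barMat ν₁ ν₂ (M 0) 1 1).re, ⟨fun hlt' => ?_, max_le c (by linarith),
      le_min (by linarith) (by linarith)⟩, N0.trans ?_, N1, N2⟩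
    · exact (mul_eq_zero.1
        (by linarith : (C₂ - C₁) * (E.barMat ν₁ ν₂ (M 0) 1 1).re = 0)).resolve_left (by linarith)
    · generalize (E.barMat ν₁ ν₂ (M 0) 1 1).re = ε
      ext i j
      fin_cases i <;> fin_cases j <;> simp
      ring
  · rintro ⟨ε, ⟨hz, hε, hε'⟩, N0, N1, N2⟩
    obtain ⟨b1, b2⟩ := max_le_iff.1 hε
    obtain ⟨b3, b4⟩ := le_min_iff.1 hε'
    refine ⟨(isPOVM_iff_barMat hW).2 ⟨fun i => ?_, ?_⟩, ?_, ?_⟩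
    · fin_cases i
      · change (E.barMat ν₁ ν₂ (M 0)).PosSemidef
        rw [N0]
        exact posSemidef_diagonal_two (by linarith) b1
      · change (E.barMat ν₁ ν₂ (M 1)).PosSemidef
        rw [N1]
        have := posSemidef_diagonal_two (by linarith : 0 ≤ r₁₁ - Q + ε) le_rfl
        rwa [Complex.ofReal_zero] at this
      · change (E.barMat ν₁ ν₂ (M 2)).PosSemidef
        rw [N2]
        have := posSemidef_diagonal_two le_rfl (by linarith : 0 ≤ r₂₂ - ε)
        rwa [Complex.ofReal_zero] at this
    · rw [N0, N1, N2, hG.gram]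
      ext i j
      fin_cases i <;> fin_cases j <;> simp
    · rw [hI, N0]
      simp
    · rw [lossCommuting, N0, N1, N2]
      simp
      rcases hC.lt_or_eq with h | h
      · exact Or.inr (hz h)
      · exact Or.inl (by rw [h, sub_self])

theorem frir_of_commuting (hne : E.ρ₁ ≠ E.ρ₂) (h₁ : IsTopEigenpair E.ρbar₁ C₁ ν₁)
    (h₂ : IsTopEigenpair E.ρbar₂ C₂ ν₂) (hC : C₁ ≤ C₂)
    (hr₁₁ : r₁₁ = (braket ν₁ E.ρ₀ ν₁).re) (hr₂₂ : r₂₂ = (braket ν₂ E.ρ₀ ν₂).re)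
    (hr₁₂ : r₁₂ = braket ν₁ E.ρ₀ ν₂) (hr₂₁ : r₂₁ = braket ν₂ E.ρ₀ ν₁)
    (hlt : 1 / 2 < C₁) (hzero : r₁₂ = 0) :
    E.IsStartDegree C₁ ∧
      E.PI C₁ = Set.Icc 0 (r₁₁ + r₂₂ * (if C₁ = C₂ then 1 else 0)) ∧
      ∀ Q ∈ E.PI C₁,
        (Q < 1 → E.IsOptRate Q (C₁ + r₂₂ * (C₂ - C₁) / (1 - Q))) ∧
        ∀ M : Fin 3 → Op, E.IsFRIRMeasurement Q M ↔
          ∃ ε : ℝ,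
            ((C₁ < C₂ → ε = 0) ∧
              (C₁ = C₂ → max 0 (Q - r₁₁) ≤ ε ∧ ε ≤ min r₂₂ Q)) ∧
            E.bar (M 0) = ((Q - ε : ℝ) : ℂ) • ketbra ν₁ ν₁ +
              (ε : ℂ) • ketbra ν₂ ν₂ ∧
            E.bar (M 1) = ((r₁₁ - Q + ε : ℝ) : ℂ) • ketbra ν₁ ν₁ ∧
            E.bar (M 2) = ((r₂₂ - ε : ℝ) : ℂ) • ketbra ν₂ ν₂ := by
  have hG := isGram hne h₁ h₂ hr₁₁ hr₂₂ hr₁₂ hr₂₁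
  rw [hzero] at hG
  have hW := isUnit_det_W hne h₁ h₂
  have hV := modCor_eq_sub_lossCommuting hne h₁ h₂ hG
  have h0 := lossCommuting_nonneg (E := E) (ν₁ := ν₁) (ν₂ := ν₂) hlt hC
  have hiff := lossCommuting_eq_zero_iff hW (probI_eq hne h₁ h₂) hG hlt hC
  have p₁ := hG.pos₁
  have p₂ := hG.pos₂
  set B : ℝ := r₁₁ + r₂₂ * (if C₁ = C₂ then 1 else 0) with hB
  have hBpos : 0 < B := by
    rw [hB]
    split_ifs <;> linarith
  have hex : ∀ Q, 0 ≤ Q → Q ≤ B →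
      ∃ M, IsPOVM M ∧ E.probI M = Q ∧ E.lossCommuting C₁ C₂ ν₁ ν₂ M = 0 := by
    intro Q hQ hQ'
    obtain ⟨ε, hε⟩ : ∃ ε : ℝ, (C₁ < C₂ → ε = 0) ∧ max 0 (Q - r₁₁) ≤ ε ∧ ε ≤ min r₂₂ Q := by
      -- The least admissible `ε`: weight on `ν₂` is used only once `Q` exceeds `r₁₁`, which cannot
      -- happen when `C₁ < C₂`.
      refine ⟨max 0 (Q - r₁₁), fun h => ?_, le_rfl, ?_⟩
      · rw [hB, if_neg h.ne] at hQ'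
        exact max_eq_left (by linarith)
      · refine max_le (le_min p₂.le hQ) (le_min ?_ (by linarith))
        rw [hB] at hQ'
        split_ifs at hQ' <;> linarith
    obtain ⟨M, N⟩ := exists_barMat_eq hW (!![((Q - ε : ℝ) : ℂ), 0; 0, (ε : ℂ)])
      (!![((r₁₁ - Q + ε : ℝ) : ℂ), 0; 0, 0]) (!![0, 0; 0, ((r₂₂ - ε : ℝ) : ℂ)])
    exact ⟨M, (hiff Q M).2 ⟨ε, hε, N⟩⟩
  have hex0 : ∃ M, IsPOVM M ∧ E.lossCommuting C₁ C₂ ν₁ ν₂ M = 0 := by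
    obtain ⟨M, hM, -, hl⟩ := hex 0 le_rfl hBpos.le
    exact ⟨M, hM, hl⟩
  have hPI : E.PI C₁ = Set.Icc 0 B := by
    ext Q
    rw [mem_PI_iff hV h0 hex0]
    refine ⟨?_, fun h => hex Q h.1 h.2⟩
    rintro ⟨M, h⟩
    obtain ⟨ε, ⟨hz, hε, hε'⟩, -⟩ := (hiff Q M).1 h
    obtain ⟨b1, b2⟩ := max_le_iff.1 hε
    obtain ⟨b3, b4⟩ := le_min_iff.1 hε'
    refine ⟨by linarith, ?_⟩
    rw [hB]
    split_ifs with hc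
    · linarith
    · have := hz (lt_of_le_of_ne hC hc)
      linarith
  refine ⟨isStartDegree_of_probI_pos hV h0 (by linarith) (hPI ▸ ⟨le_rfl, hBpos.le⟩) ?_, hPI, ?_⟩
  · obtain ⟨M, hM, hI, hl⟩ := hex _ hBpos.le le_rfl
    exact ⟨M, hM, hl, hI ▸ hBpos⟩
  · intro Q hQ
    rw [hPI] at hQ
    constructor
    · intro hQ1
      have e : C₁ + r₂₂ * (C₂ - C₁) / (1 - Q) = (C₁ * r₁₁ + C₂ * r₂₂ - C₁ * Q) / (1 - Q) := by
        have : 1 - Q ≠ 0 := by linarith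
        field_simp
        linear_combination (-C₁) * hG.add_eq_one
      rw [e]
      exact isOptRate_of_loss hV h0 (hex Q hQ.1 hQ.2) hQ1
    · intro M
      rw [isFRIRMeasurement_iff hV h0 (hex Q hQ.1 hQ.2), hiff]
      simp only [bar_eq_diag hne h₁ h₂, bar_eq_diag₁ hne h₁ h₂, bar_eq_diag₂ hne h₁ h₂]
      constructor
      · rintro ⟨ε, ⟨hz, hε⟩, h⟩
        exact ⟨ε, ⟨hz, fun _ => hε⟩, h⟩
      · rintro ⟨ε, ⟨hz, hh⟩, h⟩
        refine ⟨ε, ⟨hz, ?_⟩, h⟩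
        rcases hC.lt_or_eq with hlt' | heq
        · rw [hz hlt']
          have hQB := hQ.2
          rw [hB, if_neg hlt'.ne] at hQB
          exact ⟨max_le le_rfl (by linarith), le_min p₂.le hQ.1⟩
        · exact hh heq

end Ensemble

/-! ### Pauli algebra and the Helstrom decomposition. -/

theorem conjTranspose_dotSigma (u : EuclideanSpace ℝ (Fin 3)) : (dotSigma u)ᴴ = dotSigma u := by
  ext i j
  fin_cases i <;> fin_cases j <;> simp [dotSigma, pauli, Fin.sum_univ_three]

theorem trace_dotSigma (u : EuclideanSpace ℝ (Fin 3)) : (dotSigma u).trace = 0 := by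
  simp [dotSigma, pauli, Fin.sum_univ_three, Matrix.trace_fin_two]

theorem dotSigma_smul (c : ℝ) (u : EuclideanSpace ℝ (Fin 3)) :
    dotSigma (c • u) = (c : ℂ) • dotSigma u := by
  simp only [dotSigma, PiLp.smul_apply, smul_eq_mul, Complex.ofReal_mul, Finset.smul_sum, smul_smul]

theorem dotSigma_sub (u v : EuclideanSpace ℝ (Fin 3)) :
    dotSigma (u - v) = dotSigma u - dotSigma v := by
  simp [dotSigma, sub_smul, Finset.sum_sub_distrib]

theorem ofReal_norm_sq_eq (u : EuclideanSpace ℝ (Fin 3)) :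
    ((‖u‖ ^ 2 : ℝ) : ℂ) = (u 0 : ℂ) ^ 2 + (u 1 : ℂ) ^ 2 + (u 2 : ℂ) ^ 2 := by
  rw [EuclideanSpace.norm_sq_eq, Fin.sum_univ_three]
  simp only [Real.norm_eq_abs, sq_abs]
  push_cast
  rfl

theorem dotSigma_mul_self (u : EuclideanSpace ℝ (Fin 3)) :
    dotSigma u * dotSigma u = ((‖u‖ ^ 2 : ℝ) : ℂ) • (1 : Op) := by
  rw [ofReal_norm_sq_eq]
  ext i j
  fin_cases i <;> fin_cases j <;>
    simp [dotSigma, pauli, Fin.sum_univ_three, Matrix.mul_apply, Fin.sum_univ_two] <;>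
    ring_nf <;> simp [Complex.I_sq]

theorem det_smul_one_add_dotSigma (c : ℂ) (u : EuclideanSpace ℝ (Fin 3)) :
    (c • (1 : Op) + dotSigma u).det = c ^ 2 - ((‖u‖ ^ 2 : ℝ) : ℂ) := by
  rw [ofReal_norm_sq_eq, Matrix.det_fin_two]
  simp [dotSigma, pauli, Fin.sum_univ_three]
  ring_nf
  simp [Complex.I_sq]
  ring

/-- The smaller eigenvalue `m` of a Hermitian `2 × 2` matrix `A`: `A - m` is positive semidefinite
and singular. -/
theorem posSemidef_sub_min_eigenvalue (x y : ℝ) (g : ℂ) {m : ℝ}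
    (hm : m = (x + y - √((x - y) ^ 2 + 4 * ‖g‖ ^ 2)) / 2) :
    (!![((x - m : ℝ) : ℂ), g; star g, ((y - m : ℝ) : ℂ)] : Op).PosSemidef ∧
      (!![((x - m : ℝ) : ℂ), g; star g, ((y - m : ℝ) : ℂ)] : Op).det = 0 := by
  set r := √((x - y) ^ 2 + 4 * ‖g‖ ^ 2) with hr
  have hr2 : r ^ 2 = (x - y) ^ 2 + 4 * ‖g‖ ^ 2 := Real.sq_sqrt (by positivity)
  have hr0 : |x - y| ≤ r := Real.abs_le_sqrt (by nlinarith [sq_nonneg ‖g‖])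
  obtain ⟨ha, hb⟩ := abs_le.1 hr0
  have hprod : (x - m) * (y - m) = ‖g‖ ^ 2 := by
    rw [hm]
    linear_combination hr2 / 4
  have hx : 0 ≤ x - m := by rw [hm]; linarith
  have hy : 0 ≤ y - m := by rw [hm]; linarith
  constructor
  -- The Schur criterion needs a positive corner; when `y = m` the product relation forces `g = 0`
  -- and the matrix is diagonal.
  · rcases hy.lt_or_eq with hlt | heq
    · exact posSemidef_fin_two hlt rfl hprod.ge
    · rw [← heq, mul_zero] at hprod
      have hg : g = 0 := by
        rw [← norm_eq_zero]
        exact (pow_eq_zero_iff two_ne_zero).1 hprod.symm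
      rw [← heq, hg, star_zero]
      exact posSemidef_diagonal_two hx le_rfl
  · rw [Matrix.det_fin_two_of, RCLike.star_def, Complex.mul_conj, ← Complex.ofReal_mul, hprod,
      Complex.sq_norm, sub_self]

namespace Ensemble

variable {E : Ensemble} {C₁ C₂ : ℝ} {ν₁ ν₂ : Fin 2 → ℂ}

theorem q₁_smul_sub_q₂_smul (E : Ensemble) : (E.q₁ : ℂ) • E.ρ₁ - (E.q₂ : ℂ) • E.ρ₂ =
    (1 / 2 : ℂ) • (((E.q₁ - E.q₂ : ℝ) : ℂ) • (1 : Op) + dotSigma E.blochDiff) := by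
  rw [blochDiff, dotSigma_sub, dotSigma_smul, dotSigma_smul]
  nth_rewrite 1 [E.ρ₁_density.eq_bloch]
  nth_rewrite 1 [E.ρ₂_density.eq_bloch]
  push_cast
  module

theorem weighted_difference_eq (hne : E.ρ₁ ≠ E.ρ₂) (h₁ : IsTopEigenpair E.ρbar₁ C₁ ν₁)
    (h₂ : IsTopEigenpair E.ρbar₂ C₂ ν₂) : (E.q₁ : ℂ) • E.ρ₁ - (E.q₂ : ℂ) • E.ρ₂ =
      E.W ν₁ ν₂ * !![((2 * C₁ - 1 : ℝ) : ℂ), 0; 0, ((1 - 2 * C₂ : ℝ) : ℂ)] * (E.W ν₁ ν₂)ᴴ := by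
  rw [q₁_smul_ρ₁_eq hne h₁ h₂, q₂_smul_ρ₂_eq hne h₁ h₂, ← Matrix.sub_mul, ← Matrix.mul_sub]
  congr 2
  ext i j
  fin_cases i <;> fin_cases j <;> simp <;> ring

/-- The determinant of `q₁ρ₁ - q₂ρ₂` is `(e² - l²)/4` by Bloch vectors and `|det W|² (2C₁ - 1)(1 -
2C₂)` by diagonalization. The latter is negative, so the weighted difference has eigenvalues of both
signs. -/
theorem abs_sub_lt_l (hne : E.ρ₁ ≠ E.ρ₂) (h₁ : IsTopEigenpair E.ρbar₁ C₁ ν₁)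
    (h₂ : IsTopEigenpair E.ρbar₂ C₂ ν₂) (hlt : 1 / 2 < C₁) (hC : C₁ ≤ C₂) :
    |E.q₁ - E.q₂| < E.l := by
  have hd := congrArg Matrix.det (weighted_difference_eq hne h₁ h₂)
  rw [q₁_smul_sub_q₂_smul, Matrix.det_smul, det_smul_one_add_dotSigma, Matrix.det_mul,
    Matrix.det_mul, Matrix.det_conjTranspose, Matrix.det_fin_two_of] at hd
  have hn : (E.W ν₁ ν₂).det * star (E.W ν₁ ν₂).det = ((‖(E.W ν₁ ν₂).det‖ ^ 2 : ℝ) : ℂ) := by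
    rw [RCLike.star_def, Complex.mul_conj, Complex.sq_norm]
  have hd' : ((1 / 4 * ((E.q₁ - E.q₂) ^ 2 - ‖E.blochDiff‖ ^ 2) : ℝ) : ℂ) =
      ((‖(E.W ν₁ ν₂).det‖ ^ 2 * ((2 * C₁ - 1) * (1 - 2 * C₂)) : ℝ) : ℂ) := by
    rw [Complex.ofReal_mul (‖(E.W ν₁ ν₂).det‖ ^ 2), ← hn]
    simp at hd ⊢
    linear_combination hd
  have hr := Complex.ofReal_injective hd'
  have hpos : 0 < ‖(E.W ν₁ ν₂).det‖ ^ 2 := by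
    have := (isUnit_det_W hne h₁ h₂).ne_zero
    positivity
  refine abs_lt_of_sq_lt_sq ?_ (norm_nonneg _)
  have : 0 < ‖(E.W ν₁ ν₂).det‖ ^ 2 * ((2 * C₁ - 1) * (2 * C₂ - 1)) :=
    mul_pos hpos (mul_pos (by linarith) (by linarith))
  rw [l]
  linarith

/-- The spectral decomposition `q₁ ρ₁ - q₂ ρ₂ = s P - t (1 - P)` with `s, t > 0`. -/
structure IsHelstrom (E : Ensemble) (P : Op) (s t : ℝ) : Prop where
  herm : Pᴴ = P
  idem : P * P = P
  trace : P.trace = 1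
  s_pos : 0 < s
  t_pos : 0 < t
  diff : (E.q₁ : ℂ) • E.ρ₁ - (E.q₂ : ℂ) • E.ρ₂ = (s : ℂ) • P - (t : ℂ) • (1 - P)
  sub : s - t = E.q₁ - E.q₂
  add : s + t = E.l

theorem isHelstrom (h : |E.q₁ - E.q₂| < E.l) :
    E.IsHelstrom ((1 / 2 : ℂ) • (1 + dotSigma (‖E.blochDiff‖⁻¹ • E.blochDiff)))
      ((E.l + (E.q₁ - E.q₂)) / 2) ((E.l - (E.q₁ - E.q₂)) / 2) := by
  obtain ⟨ha, hb⟩ := abs_lt.1 h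
  have hl : 0 < E.l := (abs_nonneg _).trans_lt h
  have hn : ‖‖E.blochDiff‖⁻¹ • E.blochDiff‖ = 1 := by
    rw [norm_smul, norm_inv, norm_norm]
    exact inv_mul_cancel₀ hl.ne'
  refine ⟨?_, ?_, ?_, by linarith, by linarith, ?_, by ring, by ring⟩
  · rw [Matrix.conjTranspose_smul, Matrix.conjTranspose_add, conjTranspose_dotSigma,
      Matrix.conjTranspose_one]
    simp
  · have hsq := dotSigma_mul_self (‖E.blochDiff‖⁻¹ • E.blochDiff)
    rw [hn] at hsq
    generalize dotSigma (‖E.blochDiff‖⁻¹ • E.blochDiff) = A at *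
    rw [Matrix.smul_mul, Matrix.mul_smul, Matrix.mul_add, Matrix.add_mul, Matrix.add_mul, hsq]
    simp only [Matrix.one_mul, Matrix.mul_one, one_pow, Complex.ofReal_one]
    module
  · rw [Matrix.trace_smul, Matrix.trace_add, trace_dotSigma, Matrix.trace_one]
    simp
  · rw [q₁_smul_sub_q₂_smul, dotSigma_smul]
    have hl' : (E.l : ℂ) * (((‖E.blochDiff‖⁻¹ : ℝ) : ℂ)) = 1 := by
      rw [← Complex.ofReal_mul]
      exact_mod_cast mul_inv_cancel₀ hl.ne'
    generalize ((‖E.blochDiff‖⁻¹ : ℝ) : ℂ) = c at *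
    have e : dotSigma E.blochDiff = ((E.l : ℂ) * c) • dotSigma E.blochDiff := by rw [hl', one_smul]
    conv_lhs => rw [e]
    push_cast
    module

variable {P : Op} {s t : ℝ}

/-- The Lagrange operator `q₁ ρ₁ + t (1 - P)` of minimum-error discrimination. -/
noncomputable def lagrange (E : Ensemble) (P : Op) (t : ℝ) : Op :=
  (E.q₁ : ℂ) • E.ρ₁ + (t : ℂ) • (1 - P)

namespace IsHelstrom

variable (hP : E.IsHelstrom P s t)
include hP

theorem lagrange_eq : E.lagrange P t = (E.q₂ : ℂ) • E.ρ₂ + (s : ℂ) • P := by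
  rw [lagrange, eq_add_of_sub_eq hP.diff]
  abel

theorem posSemidef : P.PosSemidef := by
  have := Matrix.posSemidef_conjTranspose_mul_self P
  rwa [hP.herm, hP.idem] at this

theorem posSemidef_one_sub : (1 - P).PosSemidef := by
  have := Matrix.posSemidef_conjTranspose_mul_self (1 - P)
  rw [Matrix.conjTranspose_sub, hP.herm, Matrix.conjTranspose_one, Matrix.mul_sub, Matrix.sub_mul,
    Matrix.sub_mul, hP.idem] at this
  simpa using this

/-- Averaging the two expressions of the Lagrange operator gives half of `ρ₀ + |q₁ρ₁ - q₂ρ₂|`. -/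
theorem lagrange_eq_half : E.lagrange P t =
    (1 / 2 : ℂ) • (E.ρ₀ + ((s : ℂ) • P + (t : ℂ) • (1 - P))) := by
  have h : (1 / 2 : ℂ) • (E.lagrange P t + E.lagrange P t) = E.lagrange P t := by module
  rw [← h]
  nth_rewrite 2 [hP.lagrange_eq]
  rw [lagrange, ρ₀]
  module

/-- With `Δ = q₁ρ₁ - q₂ρ₂`, having eigenvalues `s` and `-t`, interpolation gives `|Δ| = 2st/(s+t) +
((s-t)/(s+t)) Δ`. This is the source of the coefficients in `γ`, `χ₁` and `χ₂`. -/
theorem lagrange_eq_l : E.lagrange P t = (1 / 2 : ℂ) • E.ρ₀ +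
    (((E.l ^ 2 - E.e ^ 2) / (4 * E.l) : ℝ) : ℂ) • (1 : Op) +
    (((2 * E.q₁ - 1) / (2 * E.l) : ℝ) : ℂ) • ((E.q₁ : ℂ) • E.ρ₁ - (E.q₂ : ℂ) • E.ρ₂) := by
  have hst : (s + t : ℝ) ≠ 0 := (add_pos hP.s_pos hP.t_pos).ne'
  have hq : 2 * E.q₁ - 1 = s - t := by linarith [hP.sub, E.q_sum]
  have e₁ : (E.l ^ 2 - E.e ^ 2) / (4 * E.l) = s * t / (s + t) := by
    rw [e, sq_abs, ← hP.sub, ← hP.add]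
    field_simp
    ring
  have hst' : (s + t : ℂ) ≠ 0 := by exact_mod_cast hst
  rw [hP.lagrange_eq_half, hP.diff, e₁, hq, ← hP.add, smul_add, add_assoc]
  congr 1
  have a₁ : (1 / 2 * s : ℂ) = s * t / (s + t) + (s - t) / (2 * (s + t)) * s := by
    field_simp
    ring
  have a₂ : (1 / 2 * t : ℂ) = s * t / (s + t) - (s - t) / (2 * (s + t)) * t := by
    field_simp
    ring
  push_cast
  rw [smul_add, smul_smul, smul_smul, a₁, a₂]
  module

/-- Completeness gives `Σ tr[K Mᵢ] = tr K = (1 + l)/2`, and the operators `K - q₁ρ₁ = t(1 - P)` and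
`K - q₂ρ₂ = sP` supply the last two loss terms. -/
theorem modCor_eq (q : ℝ) {M : Fin 3 → Op} (hM : IsPOVM M) :
    E.modCor q M = (1 + E.l) / 2 - (((E.lagrange P t - (q : ℂ) • E.ρ₀) * M 0).trace.re +
      t * ((1 - P) * M 1).trace.re + s * (P * M 2).trace.re) := by
  have h : M 0 + M 1 + M 2 = 1 := by rw [← hM.2, Fin.sum_univ_three]
  have hK : (E.lagrange P t).trace.re = (1 + E.l) / 2 := by
    rw [lagrange, Matrix.trace_add, Matrix.trace_smul, Matrix.trace_smul, Matrix.trace_sub, hP.trace,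
      E.ρ₁_density.2, Matrix.trace_one]
    simp
    linarith [hP.sub, hP.add, E.q_sum]
  have e₁ : (E.lagrange P t * M 1).trace.re =
      E.q₁ * (E.ρ₁ * M 1).trace.re + t * ((1 - P) * M 1).trace.re := by
    rw [lagrange, Matrix.add_mul, Matrix.trace_add, Matrix.smul_mul, Matrix.smul_mul,
      Matrix.trace_smul, Matrix.trace_smul, Complex.add_re, smul_eq_mul, smul_eq_mul,
      Complex.re_ofReal_mul, Complex.re_ofReal_mul]
  have e₂ : (E.lagrange P t * M 2).trace.re =
      E.q₂ * (E.ρ₂ * M 2).trace.re + s * (P * M 2).trace.re := by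
    rw [hP.lagrange_eq, Matrix.add_mul, Matrix.trace_add, Matrix.smul_mul, Matrix.smul_mul,
      Matrix.trace_smul, Matrix.trace_smul, Complex.add_re, smul_eq_mul, smul_eq_mul,
      Complex.re_ofReal_mul, Complex.re_ofReal_mul]
  have e₀ : ((E.lagrange P t - (q : ℂ) • E.ρ₀) * M 0).trace.re =
      (E.lagrange P t * M 0).trace.re - q * (E.ρ₀ * M 0).trace.re := by
    rw [Matrix.sub_mul, Matrix.trace_sub, Matrix.smul_mul, Matrix.trace_smul, Complex.sub_re,
      smul_eq_mul, Complex.re_ofReal_mul]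
  have hs : (E.lagrange P t * M 0).trace.re + (E.lagrange P t * M 1).trace.re +
      (E.lagrange P t * M 2).trace.re = (E.lagrange P t).trace.re := by
    rw [← Complex.add_re, ← Complex.add_re, ← Matrix.trace_add, ← Matrix.trace_add,
      ← Matrix.mul_add, ← Matrix.mul_add, h, Matrix.mul_one]
  rw [modCor, probI, probCor]
  linarith

end IsHelstrom

end Ensemble

/-- The orthogonal projector onto the line spanned by a nonzero vector. -/
theorem exists_rankOne_projector {G : Op} {φ : Fin 2 → ℂ} (hφ : φ ≠ 0) (h : G *ᵥ φ = 0) :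
    ∃ H : Op, Hᴴ = H ∧ H * H = H ∧ H ≠ 0 ∧ G * H = 0 := by
  have hn : star φ ⬝ᵥ φ ≠ 0 := fun h0 => hφ (dotProduct_star_self_eq_zero.1 h0)
  have hs : star (star φ ⬝ᵥ φ) = star φ ⬝ᵥ φ := by
    rw [← Matrix.star_dotProduct]
  refine ⟨(star φ ⬝ᵥ φ)⁻¹ • vecMulVec φ (star φ), ?_, ?_, ?_, ?_⟩
  · rw [Matrix.conjTranspose_smul, star_inv₀, hs, Matrix.conjTranspose_vecMulVec, star_star]
  · rw [Matrix.smul_mul, Matrix.mul_smul, Matrix.vecMulVec_mul_vecMulVec, Matrix.vecMulVec_smul,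
      smul_smul, smul_smul, mul_assoc, inv_mul_cancel₀ hn, mul_one]
  · rw [smul_ne_zero_iff]
    exact ⟨inv_ne_zero hn, fun h0 => (Matrix.vecMulVec_eq_zero.1 h0).elim hφ (star_ne_zero.2 hφ)⟩
  · rw [Matrix.mul_smul, Matrix.mul_vecMulVec, h, Matrix.zero_vecMulVec, smul_zero]

/-! ### The slack operator and the case `1/2 < C₁` with `ρ₁₂ ≠ 0`. -/

namespace Ensemble

variable {E : Ensemble} {C₁ C₂ : ℝ} {ν₁ ν₂ : Fin 2 → ℂ} {P : Op} {s t : ℝ}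

/-- The operator `K - m ρ₀` that certifies optimality for inconclusive degree `m`. -/
noncomputable def slack (E : Ensemble) (P : Op) (t m : ℝ) : Op :=
  E.lagrange P t - (m : ℂ) • E.ρ₀

theorem W_mul_inv_mul_conjTranspose_W (hne : E.ρ₁ ≠ E.ρ₂) (h₁ : IsTopEigenpair E.ρbar₁ C₁ ν₁)
    (h₂ : IsTopEigenpair E.ρbar₂ C₂ ν₂) :
    E.W ν₁ ν₂ * ((colOp ν₁ ν₂)ᴴ * E.ρ₀⁻¹ * colOp ν₁ ν₂) * (E.W ν₁ ν₂)ᴴ = 1 := by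
  have hS := isUnit_det_sqrtρ₀ hne
  have hU := colOp_mul_conjTranspose_colOp hne h₁ h₂
  rw [conjTranspose_W, W, ← E.sqrtρ₀_mul_self, Matrix.mul_inv_rev]
  calc _ = E.sqrtρ₀ * (colOp ν₁ ν₂ * (colOp ν₁ ν₂)ᴴ) * E.sqrtρ₀⁻¹ *
        (E.sqrtρ₀⁻¹ * (colOp ν₁ ν₂ * (colOp ν₁ ν₂)ᴴ) * E.sqrtρ₀) := by
        simp only [Matrix.mul_assoc]
    _ = 1 := by
        rw [hU, Matrix.mul_one, Matrix.mul_one, Matrix.mul_nonsing_inv _ hS,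
          Matrix.nonsing_inv_mul _ hS, Matrix.one_mul]

/-- In `W` coordinates `ρ₀` becomes the identity, the identity becomes the matrix of `ρ₀⁻¹`, and the
weighted difference becomes diagonal. -/
theorem slack_eq (hne : E.ρ₁ ≠ E.ρ₂) (h₁ : IsTopEigenpair E.ρbar₁ C₁ ν₁)
    (h₂ : IsTopEigenpair E.ρbar₂ C₂ ν₂) (hP : E.IsHelstrom P s t) (m : ℝ) :
    E.slack P t m = E.W ν₁ ν₂ * !![((E.χ₁ C₁ ν₁ - m : ℝ) : ℂ), E.γ ν₁ ν₂; star (E.γ ν₁ ν₂),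
      ((E.χ₂ C₂ ν₂ - m : ℝ) : ℂ)] * (E.W ν₁ ν₂)ᴴ := by
  have hX := ((ρ₀_posDef hne).posSemidef.inv).conjTranspose_mul_mul_same (colOp ν₁ ν₂)
  have a := diag_eq_re hX 0
  have b := diag_eq_re hX 1
  have c := hX.isHermitian.apply 1 0
  rw [conjTranspose_colOp_mul_mul] at a b c
  simp only [Matrix.of_apply, Matrix.cons_val_zero, Matrix.cons_val_one, Matrix.cons_val_fin_one,
    Matrix.cons_val'] at a b c
  have hq : 2 * E.q₂ - 1 = -(2 * E.q₁ - 1) := by linarith [E.q_sum]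
  have h1 := W_mul_inv_mul_conjTranspose_W hne h₁ h₂
  rw [conjTranspose_colOp_mul_mul] at h1
  have key : (!![((E.χ₁ C₁ ν₁ - m : ℝ) : ℂ), E.γ ν₁ ν₂; star (E.γ ν₁ ν₂),
      ((E.χ₂ C₂ ν₂ - m : ℝ) : ℂ)] : Op) = (1 / 2 : ℂ) • (1 : Op) +
      (((E.l ^ 2 - E.e ^ 2) / (4 * E.l) : ℝ) : ℂ) • !![braket ν₁ E.ρ₀⁻¹ ν₁, braket ν₁ E.ρ₀⁻¹ ν₂;
        braket ν₂ E.ρ₀⁻¹ ν₁, braket ν₂ E.ρ₀⁻¹ ν₂] +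
      (((2 * E.q₁ - 1) / (2 * E.l) : ℝ) : ℂ) •
        !![((2 * C₁ - 1 : ℝ) : ℂ), 0; 0, ((1 - 2 * C₂ : ℝ) : ℂ)] - (m : ℂ) • (1 : Op) := by
    rw [χ₁, χ₂, γ, γ, γ, hq, Complex.re_ofReal_mul, Complex.re_ofReal_mul]
    ext i j
    fin_cases i <;> fin_cases j <;> simp
    · rw [a]
      simp
      ring
    · rw [← c]
      simp
    · rw [b]
      simp
      ring
  rw [key]
  simp only [Matrix.mul_add, Matrix.mul_sub, Matrix.add_mul, Matrix.sub_mul, Matrix.mul_smul,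
    Matrix.smul_mul, h1, Matrix.mul_one, W_mul_conjTranspose_W hne h₁ h₂,
    ← weighted_difference_eq hne h₁ h₂]
  rw [slack, hP.lagrange_eq_l]

theorem slack_χ (hne : E.ρ₁ ≠ E.ρ₂) (h₁ : IsTopEigenpair E.ρbar₁ C₁ ν₁)
    (h₂ : IsTopEigenpair E.ρbar₂ C₂ ν₂) (hP : E.IsHelstrom P s t) :
    (E.slack P t (E.χ C₁ C₂ ν₁ ν₂)).PosSemidef ∧
      ∃ φ, φ ≠ 0 ∧ E.slack P t (E.χ C₁ C₂ ν₁ ν₂) *ᵥ φ = 0 := by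
  obtain ⟨hp, hd⟩ := posSemidef_sub_min_eigenvalue (E.χ₁ C₁ ν₁) (E.χ₂ C₂ ν₂) (E.γ ν₁ ν₂)
    (m := E.χ C₁ C₂ ν₁ ν₂) rfl
  rw [slack_eq hne h₁ h₂ hP]
  refine ⟨hp.mul_mul_conjTranspose_same _, Matrix.exists_mulVec_eq_zero_iff.2 ?_⟩
  rw [Matrix.det_mul, Matrix.det_mul, hd, mul_zero, zero_mul]

namespace IsHelstrom

/-- Pairing the kernel equation with `φ` gives `(2m - 1)⟨φ|ρ₀|φ⟩ = ⟨φ|sP + t(1 - P)|φ⟩ ≥ 0`. This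
supplies the positivity of `χ`. -/
theorem half_le (hne : E.ρ₁ ≠ E.ρ₂) (hP : E.IsHelstrom P s t) {m : ℝ} {φ : Fin 2 → ℂ}
    (hφ : φ ≠ 0) (h : E.slack P t m *ᵥ φ = 0) : 1 / 2 ≤ m := by
  have hA : ((s : ℂ) • P + (t : ℂ) • (1 - P)).PosSemidef :=
    (hP.posSemidef.smul (by exact_mod_cast hP.s_pos.le)).add
      (hP.posSemidef_one_sub.smul (by exact_mod_cast hP.t_pos.le))
  have ha := (Complex.le_def.1 (hA.dotProduct_mulVec_nonneg φ)).1
  have hρ := (Complex.lt_def.1 ((ρ₀_posDef hne).dotProduct_mulVec_pos hφ)).1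
  have h' := congrArg (fun v => (star φ ⬝ᵥ v).re) h
  rw [slack, hP.lagrange_eq_half, Matrix.sub_mulVec, Matrix.smul_mulVec, Matrix.smul_mulVec,
    Matrix.add_mulVec] at h'
  simp only [dotProduct_sub, dotProduct_smul, dotProduct_add, dotProduct_zero, smul_eq_mul,
    Complex.sub_re, Complex.re_ofReal_mul, Complex.zero_re] at h'
  have e : (1 / 2 : ℂ) = ((1 / 2 : ℝ) : ℂ) := by push_cast; rfl
  rw [e, Complex.re_ofReal_mul, Complex.add_re] at h'
  simp only [Complex.zero_re] at ha hρ
  by_contra hlt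
  nlinarith

/-- A common eigenvector in the kernel of the slack operator forces `ρ₁₂ = 0`. -/
theorem eq_zero_of_slack_mulVec (hne : E.ρ₁ ≠ E.ρ₂) (h₁ : IsTopEigenpair E.ρbar₁ C₁ ν₁)
    (h₂ : IsTopEigenpair E.ρbar₂ C₂ ν₂) (hlt : 1 / 2 < C₁) (hC : C₁ ≤ C₂)
    {r₁₁ r₂₂ : ℝ} {r₁₂ r₂₁ : ℂ} (hG : E.IsGram ν₁ ν₂ r₁₁ r₂₂ r₁₂ r₂₁)
    (hP : E.IsHelstrom P s t) {m : ℝ} {y : Fin 2 → ℂ} (hy : y ≠ 0)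
    (h : E.slack P t m *ᵥ y = 0) {a b : ℂ} (hb : b ≠ 0)
    (hΔ : ((E.q₁ : ℂ) • E.ρ₁ - (E.q₂ : ℂ) • E.ρ₂) *ᵥ y = a • y)
    (hA : ((s : ℂ) • P + (t : ℂ) • (1 - P)) *ᵥ y = b • y) : r₁₂ = 0 := by
  have hW := isUnit_det_W hne h₁ h₂
  have hinj : ∀ v, E.W ν₁ ν₂ *ᵥ v = 0 → v = 0 := fun v hv =>
    Matrix.eq_zero_of_mulVec_eq_zero hW.ne_zero hv
  rw [slack, hP.lagrange_eq_half, Matrix.sub_mulVec, Matrix.smul_mulVec, Matrix.smul_mulVec,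
    Matrix.add_mulVec, hA] at h
  have hm : (m - 1 / 2 : ℂ) ≠ 0 := by
    intro h0
    have h' : (1 / 2 * b) • y = 0 := by
      rw [← h, sub_eq_zero.1 h0]
      module
    exact (smul_ne_zero (mul_ne_zero (by norm_num) hb) hy) h'
  have hρ : E.ρ₀ *ᵥ y = ((1 / 2 * b) / (m - 1 / 2) : ℂ) • y := by
    have h' : (m - 1 / 2 : ℂ) • (E.ρ₀ *ᵥ y) = (1 / 2 * b) • y := by
      rw [← sub_eq_zero, ← neg_eq_zero, ← h]
      module
    rw [div_eq_inv_mul, ← smul_smul, ← h', smul_smul, inv_mul_cancel₀ hm, one_smul]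
  have hμ : ((1 / 2 * b) / (m - 1 / 2) : ℂ) ≠ 0 :=
    div_ne_zero (mul_ne_zero (by norm_num) hb) hm
  generalize ((1 / 2 * b) / (m - 1 / 2) : ℂ) = μ at *
  -- The vector `y` is an eigenvector of `ρ₀ = W Wᴴ` and of the weighted difference, so `z` is a
  -- common eigenvector of the Gram matrix and of `diag(2C₁ - 1, 1 - 2C₂)`.
  set z := (E.W ν₁ ν₂)ᴴ *ᵥ y with hz
  have hWz : E.W ν₁ ν₂ *ᵥ z = μ • y := by
    rw [hz, Matrix.mulVec_mulVec, W_mul_conjTranspose_W hne h₁ h₂, hρ]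
  have hz0 : z ≠ 0 := by
    intro h0
    rw [h0, Matrix.mulVec_zero] at hWz
    exact smul_ne_zero hμ hy hWz.symm
  have hR : ((E.W ν₁ ν₂)ᴴ * E.W ν₁ ν₂) *ᵥ z = μ • z := by
    rw [← Matrix.mulVec_mulVec, hWz, Matrix.mulVec_smul, ← hz]
  have hD : μ • (!![((2 * C₁ - 1 : ℝ) : ℂ), 0; 0, ((1 - 2 * C₂ : ℝ) : ℂ)] *ᵥ z) = a • z := by
    rw [← sub_eq_zero]
    apply hinj
    rw [Matrix.mulVec_sub, Matrix.mulVec_smul, Matrix.mulVec_smul, hWz, Matrix.mulVec_mulVec, hz,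
      Matrix.mulVec_mulVec, ← weighted_difference_eq hne h₁ h₂, hΔ, smul_comm, sub_self]
  rw [hG.gram] at hR
  have d0 := congrFun hD 0
  have d1 := congrFun hD 1
  have e0 := congrFun hR 0
  have e1 := congrFun hR 1
  simp only [Matrix.mulVec, dotProduct, Fin.sum_univ_two, Pi.smul_apply, smul_eq_mul,
    Matrix.of_apply, Matrix.cons_val_zero, Matrix.cons_val_one, Matrix.cons_val_fin_one,
    Matrix.cons_val', zero_mul, add_zero, zero_add] at d0 d1 e0 e1
  by_cases z0 : z 0 = 0
  · have z1 : z 1 ≠ 0 := fun z1 => hz0 (by ext i; fin_cases i <;> simp [z0, z1])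
    rw [z0, mul_zero, mul_zero, zero_add] at e0
    exact (mul_eq_zero.1 e0).resolve_right z1
  · by_cases z1 : z 1 = 0
    · rw [z1, mul_zero, mul_zero, add_zero] at e1
      have h21 := (mul_eq_zero.1 e1).resolve_right z0
      rw [hG.star_eq] at h21
      exact star_eq_zero.1 h21
    -- Two nonzero coordinates would force `2C₁ - 1 = 1 - 2C₂`, but these have opposite signs.
    · exfalso
      rw [← mul_assoc] at d0 d1
      have c0 := mul_right_cancel₀ z0 d0
      have c1 := mul_right_cancel₀ z1 d1
      have := Complex.ofReal_injective (mul_left_cancel₀ hμ (c0.trans c1.symm))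
      linarith

/-- Optimality for an inconclusive degree `m` with positive semidefinite slack. -/
theorem loss_eq_zero_iff (hne : E.ρ₁ ≠ E.ρ₂) (h₁ : IsTopEigenpair E.ρbar₁ C₁ ν₁)
    (h₂ : IsTopEigenpair E.ρbar₂ C₂ ν₂) (hlt : 1 / 2 < C₁) (hC : C₁ ≤ C₂)
    {r₁₁ r₂₂ : ℝ} {r₁₂ r₂₁ : ℂ} (hG : E.IsGram ν₁ ν₂ r₁₁ r₂₂ r₁₂ r₂₁) (hr : r₁₂ ≠ 0)
    (hP : E.IsHelstrom P s t) {m : ℝ} (hps : (E.slack P t m).PosSemidef) (M : Fin 3 → Op) :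
    (IsPOVM M ∧ (E.slack P t m * M 0).trace.re + t * ((1 - P) * M 1).trace.re +
      s * (P * M 2).trace.re = 0) ↔ M 0 = 0 ∧ M 1 = P ∧ M 2 = 1 - P := by
  constructor
  · rintro ⟨hM, hl⟩
    have hsum : M 0 + M 1 + M 2 = 1 := by rw [← hM.2, Fin.sum_univ_three]
    have n₀ := trace_mul_nonneg hps (hM.1 0)
    have n₁ := mul_nonneg hP.t_pos.le (trace_mul_nonneg hP.posSemidef_one_sub (hM.1 1))
    have n₂ := mul_nonneg hP.s_pos.le (trace_mul_nonneg hP.posSemidef (hM.1 2))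
    have z₀ := mul_eq_zero_of_trace hps (hM.1 0) (by linarith)
    have z₁ := mul_eq_zero_of_trace hP.posSemidef_one_sub (hM.1 1)
      ((mul_eq_zero.1 (by linarith : t * ((1 - P) * M 1).trace.re = 0)).resolve_left hP.t_pos.ne')
    have z₂ := mul_eq_zero_of_trace hP.posSemidef (hM.1 2)
      ((mul_eq_zero.1 (by linarith : s * (P * M 2).trace.re = 0)).resolve_left hP.s_pos.ne')
    rw [Matrix.sub_mul, Matrix.one_mul, sub_eq_zero] at z₁
    have z₁' := congrArg Matrix.conjTranspose z₁
    have z₂' := congrArg Matrix.conjTranspose z₂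
    rw [Matrix.conjTranspose_mul, hP.herm, (hM.1 1).isHermitian.eq] at z₁'
    rw [Matrix.conjTranspose_mul, hP.herm, (hM.1 2).isHermitian.eq, Matrix.conjTranspose_zero] at z₂'
    -- Multiplying completeness by `P` on either side gives the same result, so `M 0` commutes with
    -- `P`.
    have l₀ : P * M 0 = P - M 1 := by
      have := congrArg (P * ·) hsum
      simp only [Matrix.mul_add, z₂, ← z₁, Matrix.mul_one, add_zero] at this
      exact eq_sub_of_add_eq this
    have l₀' : M 0 * P = P - M 1 := by
      have := congrArg (· * P) hsum
      simp only [Matrix.add_mul, z₂', ← z₁', Matrix.one_mul, add_zero] at this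
      exact eq_sub_of_add_eq this
    have hcomm : M 0 * P = P * M 0 := l₀'.trans l₀.symm
    -- A nonzero vector `P M₀ z` would lie in the range of `P` and, by commutation, in the kernel of
    -- the slack, contradicting `ρ₁₂ ≠ 0`.
    have hPM : P * M 0 = 0 := by
      by_contra hne0
      obtain ⟨z, hz⟩ := mulVec_ne_zero_exists hne0
      have hPy : P *ᵥ ((P * M 0) *ᵥ z) = (P * M 0) *ᵥ z := by
        rw [Matrix.mulVec_mulVec, ← Matrix.mul_assoc, hP.idem]
      have hGy : E.slack P t m *ᵥ ((P * M 0) *ᵥ z) = 0 := by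
        rw [Matrix.mulVec_mulVec, ← hcomm, ← Matrix.mul_assoc, z₀, Matrix.zero_mul,
          Matrix.zero_mulVec]
      generalize (P * M 0) *ᵥ z = y at *
      refine hr (hP.eq_zero_of_slack_mulVec hne h₁ h₂ hlt hC hG hz hGy (a := s) (b := s)
        (by exact_mod_cast hP.s_pos.ne') ?_ ?_)
      · rw [hP.diff, Matrix.sub_mulVec, Matrix.smul_mulVec, Matrix.smul_mulVec, Matrix.sub_mulVec,
          hPy, Matrix.one_mulVec, sub_self, smul_zero, sub_zero]
      · rw [Matrix.add_mulVec, Matrix.smul_mulVec, Matrix.smul_mulVec, Matrix.sub_mulVec,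
          hPy, Matrix.one_mulVec, sub_self, smul_zero, add_zero]
    have hM0 : M 0 = 0 := by
      by_contra hne0
      obtain ⟨z, hz⟩ := mulVec_ne_zero_exists hne0
      have hPy : P *ᵥ (M 0 *ᵥ z) = 0 := by
        rw [Matrix.mulVec_mulVec, hPM, Matrix.zero_mulVec]
      have hGy : E.slack P t m *ᵥ (M 0 *ᵥ z) = 0 := by
        rw [Matrix.mulVec_mulVec, z₀, Matrix.zero_mulVec]
      generalize M 0 *ᵥ z = y at *
      refine hr (hP.eq_zero_of_slack_mulVec hne h₁ h₂ hlt hC hG hz hGy (a := -t) (b := t)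
        (by exact_mod_cast hP.t_pos.ne') ?_ ?_)
      · rw [hP.diff, Matrix.sub_mulVec, Matrix.smul_mulVec, Matrix.smul_mulVec, Matrix.sub_mulVec,
          hPy, Matrix.one_mulVec, smul_zero, zero_sub, sub_zero, neg_smul]
      · rw [Matrix.add_mulVec, Matrix.smul_mulVec, Matrix.smul_mulVec, Matrix.sub_mulVec,
          hPy, Matrix.one_mulVec, smul_zero, zero_add, sub_zero]
    have hM1 : M 1 = P := by
      rw [hPM] at l₀
      exact (sub_eq_zero.1 l₀.symm).symm
    refine ⟨hM0, hM1, ?_⟩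
    rw [hM0, hM1, zero_add] at hsum
    exact eq_sub_of_add_eq' hsum
  · rintro ⟨e₀, e₁, e₂⟩
    refine ⟨⟨fun i => ?_, ?_⟩, ?_⟩
    · fin_cases i
      · exact e₀ ▸ Matrix.PosSemidef.zero
      · exact e₁ ▸ hP.posSemidef
      · exact e₂ ▸ hP.posSemidef_one_sub
    · rw [Fin.sum_univ_three, e₀, e₁, e₂]
      abel
    · rw [e₀, e₁, e₂, Matrix.sub_mul, Matrix.mul_sub, hP.idem]
      simp

/-- Shrink the Helstrom measurement by `T = 1 - xH`, where `H` projects onto a kernel vector of the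
slack, and assign `1 - T²` to outcome 0. The objective exceeds `(1 + l)/2` by `x((2 - x)δ - xL)`,
positive for small `x`. -/
theorem exists_modCor_gt (hne : E.ρ₁ ≠ E.ρ₂) (hP : E.IsHelstrom P s t) {m : ℝ} {φ : Fin 2 → ℂ}
    (hφ : φ ≠ 0) (h : E.slack P t m *ᵥ φ = 0) {q : ℝ} (hq : m < q) :
    ∃ M, IsPOVM M ∧ (1 + E.l) / 2 < E.modCor q M := by
  obtain ⟨H, hH, hHH, hH0, hGH⟩ := exists_rankOne_projector hφ h
  have hHps : H.PosSemidef := by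
    have := Matrix.posSemidef_conjTranspose_mul_self H
    rwa [hH, hHH] at this
  have hρ := ρ₀_posDef hne
  have hδ : 0 < (E.ρ₀ * H).trace.re := by
    refine lt_of_le_of_ne (trace_mul_nonneg hρ.posSemidef hHps) fun h0 => hH0 ?_
    have hz := mul_eq_zero_of_trace hρ.posSemidef hHps h0.symm
    have := congrArg (E.ρ₀⁻¹ * ·) hz
    simpa [← Matrix.mul_assoc, Matrix.nonsing_inv_mul _
      ((Matrix.isUnit_iff_isUnit_det _).1 hρ.isUnit)] using this
  set δ := (q - m) * (E.ρ₀ * H).trace.re with hδdef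
  have hδ' : 0 < δ := mul_pos (by linarith) hδ
  set L := t * ((1 - P) * H * P * H).trace.re + s * (P * H * (1 - P) * H).trace.re with hL
  have hden : 0 < δ + |L| := by positivity
  -- This choice ensures `x ≤ 1` and `xL < δ ≤ (2 - x)δ`.
  set x := δ / (δ + |L|) with hx
  have hx0 : 0 < x := div_pos hδ' hden
  have hx1 : x ≤ 1 := (div_le_one hden).2 (by linarith [abs_nonneg L])
  have hxL : x * L < δ := by
    have e : x * (δ + |L|) = δ := div_mul_cancel₀ _ hden.ne'
    nlinarith [le_abs_self L, mul_le_mul_of_nonneg_left (le_abs_self L) hx0.le, mul_pos hx0 hδ']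
  obtain ⟨T, hT⟩ : ∃ T : Op, T = 1 - (x : ℂ) • H := ⟨_, rfl⟩
  have hTT : Tᴴ = T := by
    rw [hT, Matrix.conjTranspose_sub, Matrix.conjTranspose_smul, hH, Matrix.conjTranspose_one]
    simp
  have hT0 : 1 - T * T = ((x * (2 - x) : ℝ) : ℂ) • H := by
    rw [hT]
    simp only [Matrix.mul_sub, Matrix.sub_mul, Matrix.one_mul, Matrix.mul_one, Matrix.mul_smul,
      Matrix.smul_mul, hHH]
    push_cast
    module
  have hM : IsPOVM ![1 - T * T, T * P * T, T * (1 - P) * T] := by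
    refine ⟨fun i => ?_, ?_⟩
    · fin_cases i
      · change (1 - T * T).PosSemidef
        rw [hT0]
        exact hHps.smul (by exact_mod_cast mul_nonneg hx0.le (by linarith))
      · have := hP.posSemidef.conjTranspose_mul_mul_same T
        rwa [hTT] at this
      · have := hP.posSemidef_one_sub.conjTranspose_mul_mul_same T
        rwa [hTT] at this
    · rw [Fin.sum_univ_three]
      change 1 - T * T + T * P * T + T * (1 - P) * T = 1
      rw [Matrix.mul_sub, Matrix.sub_mul, Matrix.mul_one]
      abel
  -- Orthogonality of `P` and `1 - P` removes the terms of order 0 and 1 in `x` from the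
  -- discrimination loss.
  have hcross : ∀ A B : Op, A * B = 0 → B * A = 0 →
      (A * (T * B * T)).trace.re = x ^ 2 * (A * H * B * H).trace.re := by
    intro A B hAB hBA
    have e : A * (T * B * T) = ((x ^ 2 : ℝ) : ℂ) • (A * H * B * H) - (x : ℂ) • (A * H * B) := by
      have e1 : A * (T * B * T) = A * B - (x : ℂ) • (A * H * B) - (x : ℂ) • (A * B * H) +
          ((x ^ 2 : ℝ) : ℂ) • (A * H * B * H) := by
        rw [hT]
        simp only [Matrix.mul_sub, Matrix.sub_mul, Matrix.smul_mul, Matrix.mul_smul, Matrix.mul_one,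
          Matrix.one_mul, Matrix.mul_assoc]
        push_cast
        module
      rw [e1, hAB, Matrix.zero_mul, smul_zero]
      abel
    have e0 : (A * H * B).trace = 0 := by
      rw [Matrix.trace_mul_comm, ← Matrix.mul_assoc, hBA, Matrix.zero_mul, Matrix.trace_zero]
    rw [e, Matrix.trace_sub, Matrix.trace_smul, Matrix.trace_smul, e0, smul_zero, sub_zero,
      smul_eq_mul, Complex.re_ofReal_mul]
  have hPQ : P * (1 - P) = 0 := by rw [Matrix.mul_sub, hP.idem, Matrix.mul_one, sub_self]
  have hQP : (1 - P) * P = 0 := by rw [Matrix.sub_mul, hP.idem, Matrix.one_mul, sub_self]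
  have hG0 : ((E.lagrange P t - (q : ℂ) • E.ρ₀) * (1 - T * T)).trace.re = -(x * (2 - x) * δ) := by
    have e : E.lagrange P t - (q : ℂ) • E.ρ₀ = E.slack P t m - ((q - m : ℝ) : ℂ) • E.ρ₀ := by
      rw [slack]
      push_cast
      module
    rw [e, hT0, Matrix.mul_smul, Matrix.sub_mul, hGH, zero_sub, Matrix.trace_smul, Matrix.trace_neg,
      Matrix.smul_mul, Matrix.trace_smul, smul_eq_mul, smul_eq_mul, Complex.re_ofReal_mul,
      Complex.neg_re, Complex.re_ofReal_mul]
    ring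
  refine ⟨_, hM, ?_⟩
  rw [hP.modCor_eq q hM]
  change _ < _ - (((E.lagrange P t - (q : ℂ) • E.ρ₀) * (1 - T * T)).trace.re +
    t * ((1 - P) * (T * P * T)).trace.re + s * (P * (T * (1 - P) * T)).trace.re)
  rw [hG0, hcross _ _ hQP hPQ, hcross _ _ hPQ hQP]
  have hfin : 0 < x * ((2 - x) * δ - x * L) :=
    mul_pos hx0 (by nlinarith)
  rw [hL] at hfin
  nlinarith

end IsHelstrom

theorem frir_of_noncommuting (hne : E.ρ₁ ≠ E.ρ₂) (h₁ : IsTopEigenpair E.ρbar₁ C₁ ν₁)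
    (h₂ : IsTopEigenpair E.ρbar₂ C₂ ν₂) (hC : C₁ ≤ C₂)
    {r₁₁ r₂₂ : ℝ} {r₁₂ r₂₁ : ℂ} (hG : E.IsGram ν₁ ν₂ r₁₁ r₂₂ r₁₂ r₂₁)
    (hlt : 1 / 2 < C₁) (hr : r₁₂ ≠ 0) :
    E.IsStartDegree (E.χ C₁ C₂ ν₁ ν₂) ∧
      E.PI (E.χ C₁ C₂ ν₁ ν₂) = {0} ∧
      E.IsOptRate 0 ((1 + E.l) / 2) ∧
      ∀ M : Fin 3 → Op, E.IsFRIRMeasurement 0 M ↔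
        M 0 = 0 ∧
        M 1 = (1 / 2 : ℂ) • (1 + dotSigma (‖E.blochDiff‖⁻¹ • E.blochDiff)) ∧
        M 2 = (1 / 2 : ℂ) • (1 - dotSigma (‖E.blochDiff‖⁻¹ • E.blochDiff)) := by
  have hP := isHelstrom (abs_sub_lt_l hne h₁ h₂ hlt hC)
  have hcompl : (1 / 2 : ℂ) • (1 - dotSigma (‖E.blochDiff‖⁻¹ • E.blochDiff)) =
      1 - (1 / 2 : ℂ) • (1 + dotSigma (‖E.blochDiff‖⁻¹ • E.blochDiff)) := by module
  rw [hcompl]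
  generalize (1 / 2 : ℂ) • (1 + dotSigma (‖E.blochDiff‖⁻¹ • E.blochDiff)) = P at *
  generalize (E.l + (E.q₁ - E.q₂)) / 2 = s at *
  generalize (E.l - (E.q₁ - E.q₂)) / 2 = t at *
  obtain ⟨hps, φ, hφ, hker⟩ := slack_χ hne h₁ h₂ hP
  have hhalf := hP.half_le hne hφ hker
  have hiff := hP.loss_eq_zero_iff hne h₁ h₂ hlt hC hG hr hps
  have hgt := fun q => hP.exists_modCor_gt hne hφ hker (q := q)
  have hV := fun M => hP.modCor_eq (E.χ C₁ C₂ ν₁ ν₂) (M := M)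
  have h0 : ∀ M, IsPOVM M → 0 ≤ ((E.slack P t (E.χ C₁ C₂ ν₁ ν₂)) * M 0).trace.re +
      t * ((1 - P) * M 1).trace.re + s * (P * M 2).trace.re := fun M hM =>
    add_nonneg (add_nonneg (trace_mul_nonneg hps (hM.1 0))
      (mul_nonneg hP.t_pos.le (trace_mul_nonneg hP.posSemidef_one_sub (hM.1 1))))
      (mul_nonneg hP.s_pos.le (trace_mul_nonneg hP.posSemidef (hM.1 2)))
  have hI : ∀ M : Fin 3 → Op, M 0 = 0 → E.probI M = 0 := by
    intro M hM
    rw [probI, hM, Matrix.mul_zero, Matrix.trace_zero, Complex.zero_re]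
  obtain ⟨hM₀, hl₀⟩ := (hiff ![0, P, 1 - P]).2 ⟨rfl, rfl, rfl⟩
  have hex : ∃ M, IsPOVM M ∧ E.probI M = 0 ∧ ((E.slack P t (E.χ C₁ C₂ ν₁ ν₂)) * M 0).trace.re +
      t * ((1 - P) * M 1).trace.re + s * (P * M 2).trace.re = 0 := ⟨_, hM₀, hI _ rfl, hl₀⟩
  have hPI : E.PI (E.χ C₁ C₂ ν₁ ν₂) = {0} := by
    ext Q
    rw [mem_PI_iff hV h0 ⟨_, hM₀, hl₀⟩, Set.mem_singleton_iff]
    refine ⟨?_, fun hQ => hQ ▸ hex⟩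
    rintro ⟨M, hM, hQ, hl⟩
    rw [← hQ, hI M ((hiff M).1 ⟨hM, hl⟩).1]
  refine ⟨isStartDegree_of_loss hV h0 (by linarith) (hPI ▸ rfl) hgt, hPI, ?_, fun M => ?_⟩
  · simpa using isOptRate_of_loss hV h0 hex zero_lt_one
  · rw [isFRIRMeasurement_iff hV h0 hex]
    constructor
    · rintro ⟨hM, -, hl⟩
      exact (hiff M).1 ⟨hM, hl⟩
    · intro h
      obtain ⟨hM, hl⟩ := (hiff M).2 h
      exact ⟨hM, hI M h.1, hl⟩

end Ensemble

end FRIR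

/-! ### Assembly of the three cases. -/

theorem mainTheorem1 (E : FRIR.Ensemble) (hne : E.ρ₁ ≠ E.ρ₂)
    (C₁ C₂ : ℝ) (ν₁ ν₂ : Fin 2 → ℂ)
    (h₁ : FRIR.IsTopEigenpair E.ρbar₁ C₁ ν₁) (h₂ : FRIR.IsTopEigenpair E.ρbar₂ C₂ ν₂)
    (hC : C₁ ≤ C₂)
    (r₁₁ r₂₂ : ℝ) (r₁₂ r₂₁ : ℂ)
    (hr₁₁ : r₁₁ = (FRIR.braket ν₁ E.ρ₀ ν₁).re) (hr₂₂ : r₂₂ = (FRIR.braket ν₂ E.ρ₀ ν₂).re)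
    (hr₁₂ : r₁₂ = FRIR.braket ν₁ E.ρ₀ ν₂) (hr₂₁ : r₂₁ = FRIR.braket ν₂ E.ρ₀ ν₁) :
    -- one of the three cases occurs
    ((C₁ ≤ 1 / 2 ∧ 1 / 2 < C₂) ∨ (1 / 2 < C₁ ∧ r₁₂ = 0) ∨ (1 / 2 < C₁ ∧ r₁₂ ≠ 0)) ∧
    -- first case
    (C₁ ≤ 1 / 2 → 1 / 2 < C₂ →
      E.IsStartDegree (1 - C₁) ∧
      E.PI (1 - C₁) = Set.Icc 0 (1 - E.Q₂ ν₁ ν₂) ∧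
      ∀ Q ∈ E.PI (1 - C₁),
        E.IsOptRate Q (1 - C₁ + (C₁ - E.q₁) / (1 - Q)) ∧
        ∀ M : Fin 3 → FRIR.Op, E.IsFRIRMeasurement Q M ↔
          ∃ ε : ℝ,
            ((C₁ < 1 / 2 → ε = 0) ∧
              (C₁ = 1 / 2 → 0 ≤ ε ∧ ε ≤ 1 - E.Q₂ ν₁ ν₂ - Q)) ∧
            E.bar (M 0) = (Q : ℂ) • FRIR.ketbra ν₁ ν₁ ∧
            E.bar (M 1) = (ε : ℂ) • FRIR.ketbra ν₁ ν₁ ∧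
            E.bar (M 2) = ((r₁₁ - Q - ε : ℝ) : ℂ) • FRIR.ketbra ν₁ ν₁ +
              r₁₂ • FRIR.ketbra ν₁ ν₂ + r₂₁ • FRIR.ketbra ν₂ ν₁ +
              (r₂₂ : ℂ) • FRIR.ketbra ν₂ ν₂) ∧
    -- second case
    (1 / 2 < C₁ → r₁₂ = 0 →
      E.IsStartDegree C₁ ∧
      E.PI C₁ = Set.Icc 0 (r₁₁ + r₂₂ * (if C₁ = C₂ then 1 else 0)) ∧
      ∀ Q ∈ E.PI C₁,
        (Q < 1 → E.IsOptRate Q (C₁ + r₂₂ * (C₂ - C₁) / (1 - Q))) ∧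
        ∀ M : Fin 3 → FRIR.Op, E.IsFRIRMeasurement Q M ↔
          ∃ ε : ℝ,
            ((C₁ < C₂ → ε = 0) ∧
              (C₁ = C₂ → max 0 (Q - r₁₁) ≤ ε ∧ ε ≤ min r₂₂ Q)) ∧
            E.bar (M 0) = ((Q - ε : ℝ) : ℂ) • FRIR.ketbra ν₁ ν₁ +
              (ε : ℂ) • FRIR.ketbra ν₂ ν₂ ∧
            E.bar (M 1) = ((r₁₁ - Q + ε : ℝ) : ℂ) • FRIR.ketbra ν₁ ν₁ ∧
            E.bar (M 2) = ((r₂₂ - ε : ℝ) : ℂ) • FRIR.ketbra ν₂ ν₂) ∧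
    -- third case
    (1 / 2 < C₁ → r₁₂ ≠ 0 →
      E.IsStartDegree (E.χ C₁ C₂ ν₁ ν₂) ∧
      E.PI (E.χ C₁ C₂ ν₁ ν₂) = {0} ∧
      E.IsOptRate 0 ((1 + E.l) / 2) ∧
      ∀ M : Fin 3 → FRIR.Op, E.IsFRIRMeasurement 0 M ↔
        M 0 = 0 ∧
        M 1 = (1 / 2 : ℂ) • (1 + FRIR.dotSigma (‖E.blochDiff‖⁻¹ • E.blochDiff)) ∧
        M 2 = (1 / 2 : ℂ) • (1 - FRIR.dotSigma (‖E.blochDiff‖⁻¹ • E.blochDiff))) := by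
  have hsum := FRIR.Ensemble.one_lt_add hne h₁ h₂
  have hG := FRIR.Ensemble.isGram hne h₁ h₂ hr₁₁ hr₂₂ hr₁₂ hr₂₁
  refine ⟨?_, ?_, ?_, ?_⟩
  · rcases le_or_gt C₁ (1 / 2) with hle | hlt
    · exact Or.inl ⟨hle, by linarith⟩
    · exact Or.inr ((eq_or_ne r₁₂ 0).imp (⟨hlt, ·⟩) (⟨hlt, ·⟩))
  · exact fun hle _ => FRIR.Ensemble.frir_of_le_half hne h₁ h₂ hr₁₁ hr₂₂ hr₁₂ hr₂₁ hle
  · exact FRIR.Ensemble.frir_of_commuting hne h₁ h₂ hC hr₁₁ hr₂₂ hr₁₂ hr₂₁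
  · exact FRIR.Ensemble.frir_of_noncommuting hne h₁ h₂ hC hG
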